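/- All semigroups, groups and automata are finite. For $k\ge 0$ let $C_k$ be the class of semigroups of Krohn--Rhodes complexity at most $k$, i.e. those dividing (being a quotient of a subsemigroup of) an iterated wreath product of groups and aperiodic semigroups with at most $k$ group factors. A subset $Z$ of a semigroup $S$ is \emph{pointlike with respect to $C_k$} if for every $T\in C_k$ and every relational morphism $r\colon S\to T$ there is $t\in T$ with $Z\subseteq tr^{-1}$. A semigroup $S$ with zero is a \emph{$\mathrm{GM}$ semigroup with distinguished $\mathcal J$-class $J$} if $I(S)=J\cup\{0\}$ is a $0$-simple ideal of $S$, $S$ acts faithfully by right (left) multiplication on an $\mathcal R$-class ($\mathcal L$-class) contained in $J$, and the maximal subgroups in $J$ are non-trivial. Let $G$ be the maximal subgroup at an idempotent $e\in J$ and let $R$ be the $\mathcal R$-class of $e$. The group $G$ acts freely on the left of $R$, so $R$ is identified with $G\times B$, where $B$ is the set of $G$-orbits; $S$ acts on the right of $G\times B$ by partial functions. For $N\trianglelefteq G$ let $S/N$ be the quotient of $S$ by the least congruence that identifies elements of $G$ lying in the same coset of $N$. For $N\ne G$ let $\mathrm{GM}_J(G/N)$ be the quotient of $S/N$ by the congruence: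 $s\equiv t$ iff for all $x,y$ in the image $\bar J$ of $J$ one has $xsy\in\bar J\Leftrightarrow xty\in\bar J$, and then $xsy=xty$. Let $\mathrm{GM}_J(G/G)$ be the trivial semigroup. Write $G_N$ for the maximal subgroup of $\mathrm{GM}_J(G/N)$ at the image of $e$, and $G_N\times B_N$ for the $\mathcal R$-class of the image of $e$, as above. Fix a generating set $X$ of $S$. A \emph{flow} of $\mathrm{GM}_J(G/N)$ on a deterministic automaton with state set $Q$ and alphabet $X$ (each letter being a partial function on $Q$) assigns to each $q\in Q$ a pair $qf=(Y_q,\Pi_q)$, where $Y_q\subseteq G_N\times B_N$ and $\Pi_q$ is a partition of $Y_q$, such that $(Y_q,\Pi_q)$ is invariant under the left action of $G_N$; no $\Pi_q$-class contains $(g,b)$ and $(h,b)$ with $g\ne h$; and whenever $qx$ is defined, $Y_qx\subseteq Y_{qx}$ and, for $y,y'\in Y_q$ with $yx,y'x$ defined, $y,y'$ are in the same $\Pi_q$-class iff $yx,y'x$ are in the same $\Pi_{qx}$-class. It is \emph{complete} if it remains a flow when a sink state with value $(\emptyset,\emptyset)$ is added to receive all undefined transitions, and $\bigcup_q Y_q=G_N\times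 B_N$. We say that $\mathrm{GM}_J(G/N)$ \emph{admits a flow of complexity at most $m$} if it has a complete flow on an automaton with alphabet $X$ for which the semigroup of partial functions on $Q$ generated by the letters lies in $C_m$. \textbf{Theorem.} Let $k>0$ and let $S$ be a $\mathrm{GM}$ semigroup with distinguished $\mathcal J$-class $J$ and maximal subgroup $G$ of $J$. Let $N_J^{(k)}$ be the intersection of all normal subgroups $N$ of $G$ such that $\mathrm{GM}_J(G/N)$ admits a flow of complexity at most $k-1$. Then $N_J^{(k)}$ is itself such a normal subgroup, hence the smallest one, and it is the largest subgroup of $G$ that is pointlike with respect to $C_k$. -/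

import Mathlib

universe u

namespace KRComplexity

/-! ## Green's relations -/

section Green

variable {S : Type u} [Semigroup S]

/-- `s ≤ t` in the `𝒥`-order: `s ∈ S¹ t S¹`. -/
def JLe (s t : S) : Prop := ∃ x y : WithOne S, (s : WithOne S) = x * (t : WithOne S) * y

/-- `s ≤ t` in the `ℛ`-order: `s ∈ t S¹`. -/
def RLe (s t : S) : Prop := ∃ y : WithOne S, (s : WithOne S) = (t : WithOne S) * y

/-- `s ≤ t` in the `ℒ`-order: `s ∈ S¹ t`. -/
def LLe (s t : S) : Prop := ∃ x : WithOne S, (s : WithOne S) = x * (t : WithOne S)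

/-- The `𝒥`-class of `a`. -/
def JClass (a : S) : Set S := {s | JLe s a ∧ JLe a s}

/-- The `ℛ`-class of `a`. -/
def RClass (a : S) : Set S := {s | RLe s a ∧ RLe a s}

/-- The `ℒ`-class of `a`. -/
def LClass (a : S) : Set S := {s | LLe s a ∧ LLe a s}

theorem JLe.trans {a b c : S} (h : JLe a b) (h' : JLe b c) : JLe a c := by
  obtain ⟨x, y, h⟩ := h
  obtain ⟨x', y', h'⟩ := h'
  exact ⟨x * x', y' * y, by rw [h, h']; simp only [mul_assoc]⟩

theorem jLe_mul_right (a b : S) : JLe (a * b) a := ⟨1, b, by simp⟩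

theorem jLe_mul_left (a b : S) : JLe (a * b) b := ⟨a, 1, by simp⟩

/-- The local monoid `eSe` at an idempotent `e`. -/
@[ext] structure LocalMonoid {e : S} (he : IsIdempotentElem e) : Type u where
  val : S
  left_mul : e * val = val
  right_mul : val * e = val

instance {e : S} (he : IsIdempotentElem e) : Monoid (LocalMonoid he) where
  mul a b := ⟨a.val * b.val, by rw [← mul_assoc, a.left_mul], by rw [mul_assoc, b.right_mul]⟩
  mul_assoc a b c := LocalMonoid.ext (mul_assoc a.val b.val c.val)
  one := ⟨e, he, he⟩
  one_mul a := LocalMonoid.ext a.left_mul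
  mul_one a := LocalMonoid.ext a.right_mul

/-- The maximal subgroup `G_e` of `S` at the idempotent `e`: the group of units of `eSe`. -/
abbrev MaxSubgroup {e : S} (he : IsIdempotentElem e) : Type u := (LocalMonoid he)ˣ

/-- An element of the maximal subgroup at `e`, as an element of `S`. -/
def MaxSubgroup.elt {e : S} {he : IsIdempotentElem e} (g : MaxSubgroup he) : S :=
  (Units.val g).val

end Green

/-! ## Complexity -/

/-- A semigroup is aperiodic if all of its subgroups are trivial. -/
def IsAperiodic (S : Type u) [Semigroup S] : Prop :=
  ∀ (e : S) (he : IsIdempotentElem e), Subsingleton (MaxSubgroup he)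

/-- `S` divides `T`: `S` is a quotient of a subsemigroup of `T`. -/
def Divides (S T : Type u) [Semigroup S] [Semigroup T] : Prop :=
  ∃ (U : Subsemigroup T) (f : U →ₙ* S), Function.Surjective f

/-- A semigroup `Sgp` acting on the right of a set `State` by total functions. -/
structure TransSgp : Type (u + 1) where
  State : Type u
  Sgp : Type u
  [semigroup : Semigroup Sgp]
  act : State → Sgp → State
  act_mul : ∀ q s t, act q (s * t) = act (act q s) t

attribute [instance] TransSgp.semigroup

namespace TransSgp

/-- The one-point transformation semigroup. -/
def trivial : TransSgp.{u} where
  State := PUnit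
  Sgp := PUnit
  act _ _ := PUnit.unit
  act_mul _ _ _ := rfl

/-- A group acting on itself by right multiplication. -/
def ofGroup (G : Type u) [Group G] : TransSgp.{u} where
  State := G
  Sgp := G
  act q s := q * s
  act_mul q s t := (mul_assoc q s t).symm

/-- A semigroup `A` acting by right multiplication on `A` with an identity adjoined. -/
def ofSemigroup (A : Type u) [Semigroup A] : TransSgp.{u} where
  State := WithOne A
  Sgp := A
  act q s := q * (s : WithOne A)
  act_mul q s t := by rw [WithOne.coe_mul, mul_assoc]

/-- The semigroup `F(Q, T) × S` of the wreath product `(P, T) ≀ (Q, S)`. -/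
@[ext] structure WreathSgp (V W : TransSgp.{u}) : Type u where
  fst : W.State → V.Sgp
  snd : W.Sgp

instance (V W : TransSgp.{u}) : Semigroup (WreathSgp V W) where
  mul a b := ⟨fun q => a.fst q * b.fst (W.act q a.snd), a.snd * b.snd⟩
  mul_assoc a b c := by
    refine WreathSgp.ext (funext fun q => ?_) (mul_assoc _ _ _)
    change a.fst q * b.fst (W.act q a.snd) * c.fst (W.act q (a.snd * b.snd)) =
      a.fst q * (b.fst (W.act q a.snd) * c.fst (W.act (W.act q a.snd) b.snd))
    rw [W.act_mul, mul_assoc]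

/-- The wreath product `(P, T) ≀ (Q, S)`, with action `(p, q)(f, s) = (p(qf), qs)`. -/
def wreath (V W : TransSgp.{u}) : TransSgp.{u} where
  State := V.State × W.State
  Sgp := WreathSgp V W
  act p a := (V.act p.1 (a.fst p.2), W.act p.2 a.snd)
  act_mul _ _ _ := Prod.ext (V.act_mul _ _ _) (W.act_mul _ _ _)

end TransSgp

/-- `IsWreathProduct n W`: `W` is an iterated wreath product of finite groups and finite aperiodic
semigroups in which exactly `n` of the factors are used as groups. -/
inductive IsWreathProduct : ℕ → TransSgp.{u} → Prop
  | trivial : IsWreathProduct 0 TransSgp.trivial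
  | group (n : ℕ) (G : Type u) [Group G] [Finite G] (W : TransSgp.{u}) :
      IsWreathProduct n W → IsWreathProduct (n + 1) ((TransSgp.ofGroup G).wreath W)
  | aperiodic (n : ℕ) (A : Type u) [Semigroup A] [Finite A] (W : TransSgp.{u}) :
      IsAperiodic A → IsWreathProduct n W → IsWreathProduct n ((TransSgp.ofSemigroup A).wreath W)

/-- `S` has Krohn--Rhodes complexity at most `k`, that is, `S ∈ C_k`: it divides an iterated wreath
product of finite groups and finite aperiodic semigroups with at most `k` group factors. -/
def ComplexityLe (k : ℕ) (S : Type u) [Semigroup S] : Prop :=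
  ∃ (n : ℕ) (W : TransSgp.{u}), n ≤ k ∧ IsWreathProduct n W ∧ Divides S W.Sgp

/-! ## Pointlike sets -/

/-- A relational morphism of semigroups `S → T`. -/
structure RelMorphism (S T : Type u) [Semigroup S] [Semigroup T] where
  rel : S → T → Prop
  total : ∀ s, ∃ t, rel s t
  mul : ∀ s t s' t', rel s t → rel s' t' → rel (s * s') (t * t')

/-- `Z ⊆ S` is pointlike with respect to `C_k`. -/
def IsPointlike (k : ℕ) {S : Type u} [Semigroup S] (Z : Set S) : Prop :=
  ∀ (T : Type u) [Semigroup T] [Finite T], ComplexityLe k T →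
    ∀ r : RelMorphism S T, ∃ t : T, ∀ s ∈ Z, r.rel s t

/-! ## `GM` semigroups and the quotients `GM_J(G/N)` -/

/-- The semigroup with zero `S` is a `GM` (group mapping) semigroup with distinguished
`𝒥`-class `J`: the set `J ∪ {0}` is a `0`-simple ideal `I(S)`, `S` acts faithfully on the right of
an `ℛ`-class and on the left of an `ℒ`-class contained in `J` (by partial functions, a product
that is `0` being undefined), and the maximal subgroups in `J` are non-trivial. -/
structure IsGM {S : Type u} [SemigroupWithZero S] (J : Set S) : Prop where
  jClass : ∃ a : S, J = JClass a
  zero_notMem : (0 : S) ∉ J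
  mul_mem : ∀ a ∈ J, ∀ s : S, (a * s ∈ J ∨ a * s = 0) ∧ (s * a ∈ J ∨ s * a = 0)
  not_null : ∃ a ∈ J, ∃ b ∈ J, a * b ≠ 0
  right_faithful : ∃ a ∈ J, ∀ s t : S, (∀ r ∈ RClass a, r * s = r * t) → s = t
  left_faithful : ∃ a ∈ J, ∀ s t : S, (∀ l ∈ LClass a, s * l = t * l) → s = t
  nontrivial : ∀ (e : S) (he : IsIdempotentElem e), e ∈ J → Nontrivial (MaxSubgroup he)

section Quotients

variable {S : Type u} [Semigroup S]

/-- The congruence defining `S/N`, where `N` is a normal subgroup of the maximal subgroup `G` at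
the idempotent `e` with `𝒥`-class `J`. It is generated by identifying all elements of
the ideal `I(J) = {s | J ∩ S¹ s S¹ = ∅}` and identifying elements of `G` in the same coset of `N`. -/
def cosetCon {e : S} (he : IsIdempotentElem e) (N : Subgroup (MaxSubgroup he)) : Con S :=
  conGen fun s t =>
    ((∀ a ∈ JClass e, ¬ JLe a s) ∧ (∀ a ∈ JClass e, ¬ JLe a t)) ∨
    ∃ g h : MaxSubgroup he, g⁻¹ * h ∈ N ∧ s = g.elt ∧ t = h.elt

theorem mem_jClass_of_mul {e x s y : S} (hx : x ∈ JClass e) (h : x * s * y ∈ JClass e) :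
    x * s ∈ JClass e :=
  ⟨(jLe_mul_right x s).trans hx.1, h.2.trans (jLe_mul_right _ _)⟩

theorem mem_jClass_of_mul' {e x s y : S} (hy : y ∈ JClass e) (h : x * s * y ∈ JClass e) :
    s * y ∈ JClass e :=
  ⟨(jLe_mul_left s y).trans hy.1, h.2.trans (by rw [mul_assoc]; exact jLe_mul_left _ _)⟩

/-- The `GM` congruence associated to the `𝒥`-class `J` of `e`: `s ≡ t` if for all `x, y ∈ J`,
`xsy ∈ J` if and only if `xty ∈ J`, in which case `xsy = xty`. -/
def gmCon (e : S) : Con S where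
  r s t := ∀ x ∈ JClass e, ∀ y ∈ JClass e,
    (x * s * y ∈ JClass e ↔ x * t * y ∈ JClass e) ∧ (x * s * y ∈ JClass e → x * s * y = x * t * y)
  iseqv :=
    { refl := fun _ _ _ _ _ => ⟨Iff.rfl, fun _ => rfl⟩
      symm := fun h x hx y hy =>
        ⟨(h x hx y hy).1.symm, fun h' => ((h x hx y hy).2 ((h x hx y hy).1.2 h')).symm⟩
      trans := fun h h' x hx y hy =>
        ⟨(h x hx y hy).1.trans (h' x hx y hy).1, fun h₁ =>
          ((h x hx y hy).2 h₁).trans ((h' x hx y hy).2 ((h x hx y hy).1.1 h₁))⟩ }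
  mul' := by
    intro a b c d hab hcd x hx y hy
    have key : ∀ a b c d : S,
        (∀ x ∈ JClass e, ∀ y ∈ JClass e, (x * a * y ∈ JClass e ↔ x * b * y ∈ JClass e) ∧
          (x * a * y ∈ JClass e → x * a * y = x * b * y)) →
        (∀ x ∈ JClass e, ∀ y ∈ JClass e, (x * c * y ∈ JClass e ↔ x * d * y ∈ JClass e) ∧
          (x * c * y ∈ JClass e → x * c * y = x * d * y)) →
        x * (a * c) * y ∈ JClass e →
          x * (b * d) * y ∈ JClass e ∧ x * (a * c) * y = x * (b * d) * y := by
      intro a b c d hab hcd h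
      have e1 : ∀ u v : S, x * (u * v) * y = x * u * v * y := fun u v => by
        simp only [mul_assoc]
      have e2 : ∀ u v : S, x * (u * v) * y = x * u * (v * y) := fun u v => by
        simp only [mul_assoc]
      have h1 : x * a ∈ JClass e := by
        rw [e2] at h
        exact mem_jClass_of_mul hx h
      have h2 := hcd (x * a) h1 y hy
      rw [← e1, ← e1] at h2
      have h3 : x * (a * d) * y ∈ JClass e := h2.1.1 h
      have h4 : d * y ∈ JClass e := by
        rw [e1] at h3
        exact mem_jClass_of_mul' hy h3
      have h5 := hab x hx (d * y) h4
      rw [← e2, ← e2] at h5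
      exact ⟨h5.1.1 h3, (h2.2 h).trans (h5.2 h3)⟩
    refine ⟨⟨fun h => (key a b c d hab hcd h).1, fun h => (key b a d c ?_ ?_ h).1⟩,
      fun h => (key a b c d hab hcd h).2⟩
    · exact fun x hx y hy =>
        ⟨(hab x hx y hy).1.symm, fun h' => ((hab x hx y hy).2 ((hab x hx y hy).1.2 h')).symm⟩
    · exact fun x hx y hy =>
        ⟨(hcd x hx y hy).1.symm, fun h' => ((hcd x hx y hy).2 ((hcd x hx y hy).1.2 h')).symm⟩

open Classical in
/-- The congruence on `S` whose quotient is `GM_J(G/N)`: the `GM` congruence of `S/N` associated to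
the image of `J`, pulled back to `S`. By convention `GM_J(G/G)` is the trivial semigroup. -/
noncomputable def gmQuotCon {e : S} (he : IsIdempotentElem e) (N : Subgroup (MaxSubgroup he)) :
    Con S :=
  if N = ⊤ then ⊤
  else Con.comap (fun s => (s : (cosetCon he N).Quotient)) (fun _ _ => rfl)
    (gmCon (e : (cosetCon he N).Quotient))

/-- The semigroup `GM_J(G/N)`. -/
abbrev GMQuot {e : S} (he : IsIdempotentElem e) (N : Subgroup (MaxSubgroup he)) : Type u :=
  (gmQuotCon he N).Quotient

/-- The quotient map `S → GM_J(G/N)`. -/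
noncomputable def GMQuot.mk {e : S} (he : IsIdempotentElem e) (N : Subgroup (MaxSubgroup he)) (s : S) :
    GMQuot he N := (s : (gmQuotCon he N).Quotient)

theorem GMQuot.idem {e : S} (he : IsIdempotentElem e) (N : Subgroup (MaxSubgroup he)) :
    IsIdempotentElem (GMQuot.mk he N e) :=
  congrArg (GMQuot.mk he N) (he : e * e = e)

end Quotients

/-! ## Flows -/

/-- An element `(Y, Π)` of the set-partition lattice `SP(α)`: a partition `Π` of a subset `Y` of
`α`, given by the symmetric and transitive relation "`y` and `y'` lie in the same `Π`-class". -/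
structure SetPartition (α : Type u) where
  rel : α → α → Prop
  symm : ∀ y y', rel y y' → rel y' y
  trans : ∀ y y' y'', rel y y' → rel y' y'' → rel y y''

namespace SetPartition

/-- The underlying set `Y` of `(Y, Π)`. -/
def carrier {α : Type u} (P : SetPartition α) : Set α := {y | P.rel y y}

/-- The bottom `(∅, ∅)` of the set-partition lattice. -/
def bottom (α : Type u) : SetPartition α where
  rel _ _ := False
  symm _ _ h := h
  trans _ _ _ h _ := h

end SetPartition

/-- A finite deterministic automaton with alphabet `X`: every letter defines a partial function
on the state set. -/
structure Automaton (X : Type u) where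
  State : Type u
  [finite : Finite State]
  step : State → X → Option State

namespace Automaton

variable {X : Type u}

attribute [instance] Automaton.finite

/-- The completion: a sink state is added, and undefined transitions lead to the sink. -/
def completion (A : Automaton X) : Automaton X where
  State := Option A.State
  step q x := some (q.bind fun p => A.step p x)

/-- The partial function of a letter on the states, with "undefined" represented by `none`.
Passing to the opposite monoid makes products act from left to right. -/
def letter (A : Automaton X) (x : X) : (Function.End (Option A.State))ᵐᵒᵖ :=
  MulOpposite.op fun q => q.bind fun p => A.step p x

/-- The semigroup of the transformation semigroup of an automaton: the semigroup of partial
functions on the states generated by the letters. -/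
abbrev Sgp (A : Automaton X) : Type u := Subsemigroup.closure (Set.range A.letter)

end Automaton

section Flow

variable {S : Type u} [Semigroup S] {e : S} {X : Type u}

/-- Let `R` be the `ℛ`-class of the idempotent `e`. The maximal subgroup `G` at `e` acts freely on
the left of `R` by multiplication, so that `R` is identified with `G × B`, where `B` is the set of
orbits (equivalently, the set of `ℒ`-classes meeting `R`). A set-partition pair on
`R = G × B` is a cross-section if no class contains `(g, b)` and `(h, b)` with `g ≠ h`. -/
def IsCrossSection (he : IsIdempotentElem e) (P : SetPartition (RClass e)) : Prop :=
  ∀ y y' : RClass e, P.rel y y' → (∃ g : MaxSubgroup he, (y' : S) = g.elt * y) → y = y'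

/-- A set-partition pair `(Y, Π)` on `R = G × B` is invariant under the left action of `G`. -/
def IsInvariant (he : IsIdempotentElem e) (P : SetPartition (RClass e)) : Prop :=
  ∀ (g : MaxSubgroup he) (y y' z z' : RClass e), (z : S) = g.elt * y → (z' : S) = g.elt * y' →
    P.rel y y' → P.rel z z'

/-- A flow to `SP(G × B)` on an automaton `A` with alphabet `X`, where the letter `x` acts on
`R = G × B` by right multiplication by `ι x` (undefined if the product leaves `R`). -/
structure IsFlow (he : IsIdempotentElem e) (ι : X → S) (A : Automaton X)
    (f : A.State → SetPartition (RClass e)) : Prop where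
  mapsTo : ∀ q x q', A.step q x = some q' → ∀ y z : RClass e, y ∈ (f q).carrier →
    (z : S) = y * ι x → z ∈ (f q').carrier
  injective : ∀ q x q', A.step q x = some q' → ∀ y y' z z' : RClass e,
    y ∈ (f q).carrier → y' ∈ (f q).carrier → (z : S) = y * ι x → (z' : S) = y' * ι x →
    ((f q).rel y y' ↔ (f q').rel z z')
  crossSection : ∀ q, IsCrossSection he (f q)

/-- A complete flow: a flow that remains a flow on the completion when the sink is sent to
`(∅, ∅)`, and such that every element of `G × B` occurs at some state. -/
structure IsCompleteFlow (he : IsIdempotentElem e) (ι : X → S) (A : Automaton X)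
    (f : A.State → SetPartition (RClass e)) : Prop where
  flow : IsFlow he ι A f
  flow_completion : IsFlow he ι A.completion
    (fun q : Option A.State => q.elim (SetPartition.bottom (RClass e)) f)
  cover : ∀ y : RClass e, ∃ q, y ∈ (f q).carrier

/-- There is an automaton with alphabet `X` whose transformation semigroup has complexity at most
`k` with a complete flow to the Rhodes lattice `Rh_B(G)` (the `G`-invariant cross-sections in
`SP(G × B)`). -/
def AdmitsFlow (he : IsIdempotentElem e) (ι : X → S) (k : ℕ) : Prop :=
  ∃ A : Automaton X, ComplexityLe k A.Sgp ∧ ∃ f : A.State → SetPartition (RClass e),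
    IsCompleteFlow he ι A f ∧ ∀ q, IsInvariant he (f q)

/-- The set of normal subgroups `N` of `G` such that `GM_J(G/N)`, generated by the image of the
generating set `X` of `S`, admits a flow of complexity at most `k`. -/
def flowNormals (he : IsIdempotentElem e) (X : Set S) (k : ℕ) : Set (Subgroup (MaxSubgroup he)) :=
  {N | N.Normal ∧ AdmitsFlow (GMQuot.idem he N) (fun x : X => GMQuot.mk he N x) k}

/-- The `k`-th flow normal subgroup `N_J^{(k)}`, as a subgroup of the maximal subgroup at `e`. For
`k = 0` it is the whole group. -/
def flowNormal (he : IsIdempotentElem e) (X : Set S) : ℕ → Subgroup (MaxSubgroup he)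
  | 0 => ⊤
  | k + 1 => sInf (flowNormals he X k)

end Flow

end KRComplexity

/-!
Let `H` be the maximal subgroup of `GM_J(G/N)` at the image of `e`. A flow is injective on
classes, so each transition of an automaton carrying a complete flow extends to a permutation of
the sets of elements of the `ℛ`-class. Recording these permutations gives a relational morphism to
a wreath product of a group and the semigroup of the automaton. It separates the elements of `H`,
because the classes are cross-sections. Hence, if the flow has complexity at most `k - 1`, a
subgroup of `G` that is pointlike with respect to `C_k` is trivial in `H = G/N`, that is,
contained in `N`.

Conversely, the largest pointlike subset of `G` containing `1` is a normal subgroup `N`, and then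
`H` has no non-trivial pointlike subgroup. A single relational morphism to some `T ∈ C_k`
therefore separates the subgroups of `H`, and `T` is a quotient of a semigroup with an aperiodic
homomorphism to a wreath product of a group and some `V`, where `V` has at most `k - 1` group
factors. In the relational morphism to that wreath product, let `f` be a minimal idempotent over
the image of `e`. The states of the flow are the elements `w` of `V`; two elements of the
`ℛ`-class are equivalent at `w` if some left translate of both has a common lift over `w` below
`f`. Two lifts over `w` differ by an element of a group acting on the left, hence this is an
equivalence relation, and aperiodicity makes its classes cross-sections.
-/

namespace KRComplexity

/-! ## Maximal subgroups -/

section MaxSubgroup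

variable {S T : Type u} [Semigroup S] [Semigroup T] {e : S} {he : IsIdempotentElem e}

namespace MaxSubgroup

theorem elt_injective : Function.Injective (elt : MaxSubgroup he → S) :=
  fun _ _ h => Units.ext (LocalMonoid.ext h)

theorem elt_one : (1 : MaxSubgroup he).elt = e := rfl

theorem elt_mul (g h : MaxSubgroup he) : (g * h).elt = g.elt * h.elt := rfl

theorem idem_mul_elt (g : MaxSubgroup he) : e * g.elt = g.elt := g.val.left_mul

theorem elt_mul_idem (g : MaxSubgroup he) : g.elt * e = g.elt := g.val.right_mul

theorem elt_mul_elt_inv (g : MaxSubgroup he) : g.elt * g⁻¹.elt = e := by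
  rw [← elt_mul, mul_inv_cancel, elt_one]

theorem elt_inv_mul_elt (g : MaxSubgroup he) : g⁻¹.elt * g.elt = e := by
  rw [← elt_mul, inv_mul_cancel, elt_one]

end MaxSubgroup

instance [Finite S] : Finite (LocalMonoid he) :=
  Finite.of_injective LocalMonoid.val fun _ _ => LocalMonoid.ext

namespace MaxSubgroup

theorem exists_elt_eq_of_mul_eq [Finite S] (he : IsIdempotentElem e) {a b : S} (hea : e * a = a)
    (hae : a * e = a) (hab : a * b = e) : ∃ g : MaxSubgroup he, g.elt = a := by
  let x : LocalMonoid he := ⟨a, hea, hae⟩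
  let y : LocalMonoid he := ⟨e * b * e, by rw [← mul_assoc, ← mul_assoc, he.eq],
    by rw [mul_assoc, he.eq]⟩
  have hxy : x * y = 1 := LocalMonoid.ext <| by
    change a * (e * b * e) = e
    rw [← mul_assoc, ← mul_assoc, hae, hab, he.eq]
  exact ⟨(IsUnit.of_mul_eq_one y hxy).unit, rfl⟩

theorem exists_elt_eq_of_mul_eq' [Finite S] (he : IsIdempotentElem e) {a b : S} (hea : e * a = a)
    (hae : a * e = a) (hba : b * a = e) : ∃ g : MaxSubgroup he, g.elt = a := by
  let x : LocalMonoid he := ⟨a, hea, hae⟩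
  let y : LocalMonoid he := ⟨e * b * e, by rw [← mul_assoc, ← mul_assoc, he.eq],
    by rw [mul_assoc, he.eq]⟩
  have hyx : y * x = 1 := LocalMonoid.ext <| by
    change e * b * e * a = e
    rw [mul_assoc, hea, mul_assoc, hba, he.eq]
  exact ⟨(IsUnit.of_mul_eq_one_right y hyx).unit, rfl⟩

/-- The homomorphism between the maximal subgroups at `e` and `f e` induced by `f : S →ₙ* T`. -/
def map (f : S →ₙ* T) (he : IsIdempotentElem e) : MaxSubgroup he →* MaxSubgroup (he.map f) :=
  Units.map
    { toFun a := ⟨f a.val, by rw [← map_mul, a.left_mul], by rw [← map_mul, a.right_mul]⟩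
      map_one' := rfl
      map_mul' _ _ := LocalMonoid.ext (map_mul f _ _) }

theorem elt_map (f : S →ₙ* T) (g : MaxSubgroup he) : (map f he g).elt = f g.elt := rfl

end MaxSubgroup

theorem mem_rClass_iff (he : IsIdempotentElem e) {y : S} :
    y ∈ RClass e ↔ e * y = y ∧ ∃ t, y * t = e := by
  constructor
  · rintro ⟨⟨a, ha⟩, ⟨b, hb⟩⟩
    have hey : e * y = y := by
      rw [← WithOne.coe_inj, WithOne.coe_mul, ha, ← mul_assoc, ← WithOne.coe_mul, he.eq]
    refine ⟨hey, ?_⟩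
    obtain rfl | ⟨b, rfl⟩ : b = 1 ∨ ∃ c : S, b = c :=
      WithOne.cases_on b (Or.inl rfl) fun c => Or.inr ⟨c, rfl⟩
    · exact ⟨e, by rw [← WithOne.coe_inj.1 (hb.trans (mul_one _)), he.eq]⟩
    · exact ⟨b, WithOne.coe_inj.1 hb.symm⟩
  · rintro ⟨hey, t, ht⟩
    exact ⟨⟨y, by rw [← WithOne.coe_mul, hey]⟩, ⟨t, by rw [← WithOne.coe_mul, ht]⟩⟩

theorem idem_mul_of_mem_rClass (he : IsIdempotentElem e) {y : S} (hy : y ∈ RClass e) : e * y = y :=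
  ((mem_rClass_iff he).1 hy).1

theorem mem_rClass_of_mul_mem (he : IsIdempotentElem e) {y m : S} (hy : e * y = y)
    (h : y * m ∈ RClass e) : y ∈ RClass e := by
  obtain ⟨-, t, ht⟩ := (mem_rClass_iff he).1 h
  exact (mem_rClass_iff he).2 ⟨hy, m * t, by rw [← mul_assoc, ht]⟩

theorem MaxSubgroup.elt_mul_mem_rClass (g : MaxSubgroup he) {y : S} (hy : y ∈ RClass e) :
    g.elt * y ∈ RClass e := by
  obtain ⟨-, t, ht⟩ := (mem_rClass_iff he).1 hy
  exact (mem_rClass_iff he).2 ⟨by rw [← mul_assoc, idem_mul_elt],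
    t * g⁻¹.elt, by rw [mul_assoc, ← mul_assoc y, ht, idem_mul_elt, elt_mul_elt_inv]⟩

theorem idem_mem_rClass (e : S) : e ∈ RClass e :=
  ⟨⟨1, (mul_one _).symm⟩, ⟨1, (mul_one _).symm⟩⟩

theorem MaxSubgroup.elt_mem_rClass (g : MaxSubgroup he) : g.elt ∈ RClass e :=
  g.elt_mul_idem ▸ g.elt_mul_mem_rClass (idem_mem_rClass e)

end MaxSubgroup

/-! ## Relational morphisms -/

section RelMorphism

variable {S T : Type u} [Semigroup S] [Semigroup T]

theorem exists_isIdempotentElem_mem [Finite S] {F : Set S} (hF : F.Nonempty)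
    (hmul : ∀ a ∈ F, ∀ b ∈ F, a * b ∈ F) : ∃ f ∈ F, IsIdempotentElem f := by
  let _ : TopologicalSpace S := ⊥
  have : DiscreteTopology S := ⟨rfl⟩
  exact exists_idempotent_in_compact_subsemigroup (fun _ => continuous_of_discreteTopology) F hF
    F.toFinite.isCompact hmul

namespace RelMorphism

/-- `f` is an idempotent related to `e`, minimal among the idempotents of the subsemigroup
`F` of elements related to `e`: the right ideal `f F` is the right ideal `a F` of each `a ∈ f F`. -/
structure IsMinimalOver (r : RelMorphism S T) (e : S) (f : T) : Prop where
  rel : r.rel e f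
  idem : IsIdempotentElem f
  exists_mul_eq : ∀ a, r.rel e a → f * a = a → ∃ b, r.rel e b ∧ a * b = f

variable {e : S} {r : RelMorphism S T} {f : T}

theorem exists_isMinimalOver [Finite T] (he : IsIdempotentElem e) (r : RelMorphism S T) :
    ∃ f, r.IsMinimalOver e f := by
  let F : Set T := {a | r.rel e a}
  have hmul : ∀ a ∈ F, ∀ b ∈ F, a * b ∈ F := fun a ha b hb => by
    have := r.mul e a e b ha hb
    rwa [he.eq] at this
  have hne : F.Nonempty := r.total e
  obtain ⟨a, ha, hmin⟩ := Set.exists_min_image F (fun a => ((a * ·) '' F).ncard)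
    F.toFinite hne
  obtain ⟨_, ⟨x, hx, rfl⟩, hidem⟩ := exists_isIdempotentElem_mem (F := (a * ·) '' F)
    (hne.image _) <| by
      rintro _ ⟨x, hx, rfl⟩ _ ⟨y, hy, rfl⟩
      exact ⟨x * (a * y), hmul _ hx _ (hmul _ ha _ hy), by simp only [mul_assoc]⟩
  refine ⟨a * x, hmul _ ha _ hx, hidem, fun b hb hab => ?_⟩
  have hsub : (b * ·) '' F ⊆ (a * ·) '' F := by
    rintro _ ⟨y, hy, rfl⟩
    exact ⟨x * (b * y), hmul _ hx _ (hmul _ hb _ hy), by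
      simp only; rw [← mul_assoc, ← mul_assoc, hab]⟩
  have heq : (b * ·) '' F = (a * ·) '' F :=
    Set.eq_of_subset_of_ncard_le hsub (hmin b hb) (Set.toFinite _)
  exact heq.ge ⟨x, hx, rfl⟩

theorem IsMinimalOver.exists_return (hf : r.IsMinimalOver e f) {y : S} {v : T} (hv : r.rel y v)
    (hfv : f * v = v) {t : S} (ht : y * t = e) (he : IsIdempotentElem e) :
    ∃ t' τ, r.rel t' τ ∧ y * t' = e ∧ v * τ = f := by
  obtain ⟨τ, hτ⟩ := r.total t
  obtain ⟨b, hb, hvb⟩ := hf.exists_mul_eq (v * τ) (ht ▸ r.mul _ _ _ _ hv hτ)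
    (by rw [← mul_assoc, hfv])
  exact ⟨t * e, τ * b, r.mul _ _ _ _ hτ hb, by rw [← mul_assoc, ht, he.eq],
    by rw [← mul_assoc, hvb]⟩

/-- The relational morphism generated by the pairs `(ι x, v x)`, where the `ι x` generate `S`. -/
def ofGenerators {X : Type*} (ι : X → S) (v : X → T)
    (hι : Subsemigroup.closure (Set.range ι) = ⊤) : RelMorphism S T where
  rel s t := (s, t) ∈ Subsemigroup.closure (Set.range fun x => (ι x, v x))
  total s := by
    have hs : s ∈ Subsemigroup.closure (Set.range ι) := hι ▸ Subsemigroup.mem_top s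
    induction hs using Subsemigroup.closure_induction with
    | mem s hs =>
      obtain ⟨x, rfl⟩ := hs
      exact ⟨v x, Subsemigroup.subset_closure ⟨x, rfl⟩⟩
    | mul s s' _ _ ih ih' =>
      obtain ⟨⟨t, ht⟩, ⟨t', ht'⟩⟩ := And.intro ih ih'
      exact ⟨t * t', mul_mem ht ht'⟩
  mul _ _ _ _ h h' := mul_mem h h'

end RelMorphism

end RelMorphism

/-! ## Aperiodicity -/

section Aperiodic

variable {S T U : Type u} [Semigroup S] [Semigroup T] [Semigroup U]

theorem IsAperiodic.eq_one (hS : IsAperiodic S) {e : S} {he : IsIdempotentElem e}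
    (g : MaxSubgroup he) : g = 1 :=
  (hS e he).elim g 1

theorem IsAperiodic.of_eq_one
    (h : ∀ (e : S) (he : IsIdempotentElem e) (g : MaxSubgroup he), g = 1) : IsAperiodic S :=
  fun e he => ⟨fun g g' => (h e he g).trans (h e he g').symm⟩

theorem IsAperiodic.eq_of_mul_eq [Finite S] (hS : IsAperiodic S) {e a b : S}
    (he : IsIdempotentElem e) (hea : e * a = a) (hae : a * e = a) (hab : a * b = e) : a = e := by
  obtain ⟨g, rfl⟩ := MaxSubgroup.exists_elt_eq_of_mul_eq he hea hae hab
  rw [hS.eq_one g, MaxSubgroup.elt_one]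

theorem isAperiodic_punit : IsAperiodic PUnit.{u + 1} :=
  .of_eq_one fun _ _ _ => MaxSubgroup.elt_injective rfl

theorem IsAperiodic.pi (hS : IsAperiodic S) (Q : Type u) : IsAperiodic (Q → S) :=
  .of_eq_one fun _ he g => MaxSubgroup.elt_injective <| funext fun q =>
    congrArg MaxSubgroup.elt (hS.eq_one (MaxSubgroup.map (Pi.evalMulHom (fun _ : Q => S) q) he g))

theorem IsAperiodic.exists_forall_rel {P : Type u} [Group P] [Finite S] (hS : IsAperiodic S)
    (r : RelMorphism P S) : ∃ s, ∀ g, r.rel g s := by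
  obtain ⟨f, hf⟩ := r.exists_isMinimalOver ((.one : IsIdempotentElem (1 : P)))
  refine ⟨f, fun g => ?_⟩
  obtain ⟨a, ha⟩ := r.total g
  have hx : r.rel g (f * a * f) := by
    simpa only [one_mul, mul_one] using r.mul _ _ _ _ (r.mul _ _ _ _ hf.rel ha) hf.rel
  have hfx : f * (f * a * f) = f * a * f := by simp only [← mul_assoc, hf.idem.eq]
  have hxf : f * a * f * f = f * a * f := by rw [mul_assoc, hf.idem.eq]
  obtain ⟨-, τ, -, -, hτ⟩ := hf.exists_return hx hfx (mul_inv_cancel g) .one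
  rwa [hS.eq_of_mul_eq hf.idem hfx hxf hτ] at hx

/-- A homomorphism is aperiodic if its restriction to every subgroup is injective. -/
def IsAperiodicHom (π : S →ₙ* T) : Prop :=
  ∀ (e : S) (he : IsIdempotentElem e) (g : MaxSubgroup he), π g.elt = π e → g = 1

namespace IsAperiodicHom

theorem of_injective {π : S →ₙ* T} (h : Function.Injective π) : IsAperiodicHom π :=
  fun _ _ _ hg => MaxSubgroup.elt_injective (h hg)

theorem comp {π : T →ₙ* U} {φ : S →ₙ* T} (hπ : IsAperiodicHom π) (hφ : IsAperiodicHom φ) :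
    IsAperiodicHom (π.comp φ) :=
  fun e he g hg => hφ e he g <|
    congrArg MaxSubgroup.elt (hπ (φ e) (he.map φ) (MaxSubgroup.map φ he g) hg)

theorem isAperiodic_of_forall_eq {π : S →ₙ* T} (hπ : IsAperiodicHom π) {K : Subsemigroup S} {t : T}
    (hK : ∀ s ∈ K, π s = t) : IsAperiodic K :=
  .of_eq_one fun f hf g => MaxSubgroup.elt_injective <| Subtype.ext <|
    congrArg MaxSubgroup.elt <| hπ f (hf.map (MulMemClass.subtype K))
      (MaxSubgroup.map (MulMemClass.subtype K) hf g) ((hK _ g.elt.2).trans (hK _ f.2).symm)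

end IsAperiodicHom

namespace TransSgp

/-- The projection of a wreath product onto its second factor. -/
def sndHom (V W : TransSgp.{u}) : WreathSgp V W →ₙ* W.Sgp where
  toFun := WreathSgp.snd
  map_mul' _ _ := rfl

theorem isAperiodicHom_sndHom {V W : TransSgp.{u}} [Finite V.Sgp] (hV : IsAperiodic V.Sgp) :
    IsAperiodicHom (sndHom V W) := by
  intro e he g (hg : g.elt.snd = e.snd)
  have fst_mul_eq {a b c : WreathSgp V W} (h : a * b = c) (w : W.State) :
      a.fst w * b.fst (W.act w a.snd) = c.fst w := congrArg (WreathSgp.fst · w) h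
  have hee : e.snd * e.snd = e.snd := congrArg WreathSgp.snd he
  have key (w : W.State) : g.elt.fst (W.act w e.snd) = e.fst (W.act w e.snd) := by
    have hact : W.act (W.act w e.snd) e.snd = W.act w e.snd := by rw [← W.act_mul, hee]
    have hidem := fst_mul_eq he (W.act w e.snd)
    have hleft := fst_mul_eq g.idem_mul_elt (W.act w e.snd)
    have hright := fst_mul_eq g.elt_mul_idem (W.act w e.snd)
    have hinv := fst_mul_eq g.elt_mul_elt_inv (W.act w e.snd)
    rw [hg] at hright hinv
    rw [hact] at hidem hleft hright hinv
    exact hV.eq_of_mul_eq hidem hleft hright hinv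
  refine MaxSubgroup.elt_injective (WreathSgp.ext (funext fun w => ?_) hg)
  rw [MaxSubgroup.elt_one, ← fst_mul_eq g.idem_mul_elt w, key, fst_mul_eq he]

end TransSgp

end Aperiodic

/-! ## Covers of transformation semigroups -/

namespace TransSgp

variable {U V W V' W' : TransSgp.{u}}

/-- `V` covers `W` in the sense of Eilenberg: there is a partial function `ρ` from the states of `V`
onto those of `W`, here encoded by its graph, such that every element of the semigroup of `W` is
simulated along `ρ` by an element of the semigroup of `V`. -/
def Covers (V W : TransSgp.{u}) : Prop :=
  ∃ ρ : V.State → W.State → Prop, Relator.RightUnique ρ ∧ Relator.RightTotal ρ ∧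
    ∀ s, ∃ a, ∀ p q, ρ p q → ρ (V.act p a) (W.act q s)

/-- The direct product of two transformation semigroups. -/
def prod (V W : TransSgp.{u}) : TransSgp.{u} where
  State := V.State × W.State
  Sgp := V.Sgp × W.Sgp
  act p s := (V.act p.1 s.1, W.act p.2 s.2)
  act_mul _ _ _ := Prod.ext (V.act_mul _ _ _) (W.act_mul _ _ _)

namespace Covers

theorem of_surjective (θ : V.State → W.State) (hθ : Function.Surjective θ)
    (h : ∀ s, ∃ a, ∀ p, θ (V.act p a) = W.act (θ p) s) : V.Covers W :=
  ⟨fun p q => θ p = q, fun _ _ _ h h' => h.symm.trans h', hθ, fun s =>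
    (h s).imp fun _ ha p _ hpq => hpq ▸ ha p⟩

theorem of_injective (j : W.State → V.State) (hj : Function.Injective j)
    (h : ∀ s, ∃ a, ∀ q, V.act (j q) a = j (W.act q s)) : V.Covers W :=
  ⟨fun p q => j q = p, fun _ _ _ h h' => hj (h.trans h'.symm), fun q => ⟨j q, rfl⟩, fun s =>
    (h s).imp fun _ ha _ q hpq => hpq ▸ (ha q).symm⟩

theorem trans (hUV : U.Covers V) (hVW : V.Covers W) : U.Covers W := by
  obtain ⟨ρ, hρu, hρt, hρ⟩ := hUV
  obtain ⟨σ, hσu, hσt, hσ⟩ := hVW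
  refine ⟨Relation.Comp ρ σ, ?_, fun r => ?_, fun s => ?_⟩
  · rintro p r r' ⟨q, hpq, hqr⟩ ⟨q', hpq', hqr'⟩
    obtain rfl := hρu hpq hpq'
    exact hσu hqr hqr'
  · obtain ⟨q, hq⟩ := hσt r
    exact (hρt q).imp fun p hp => ⟨q, hp, hq⟩
  · obtain ⟨a, ha⟩ := hσ s
    obtain ⟨b, hb⟩ := hρ a
    exact ⟨b, fun p r ⟨q, hpq, hqr⟩ => ⟨V.act q a, hb p q hpq, ha q r hqr⟩⟩

theorem prod (hV : V.Covers V') (hW : W.Covers W') : (V.prod W).Covers (V'.prod W') := by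
  obtain ⟨ρ, hρu, hρt, hρ⟩ := hV
  obtain ⟨σ, hσu, hσt, hσ⟩ := hW
  refine ⟨fun p q => ρ p.1 q.1 ∧ σ p.2 q.2,
    fun _ _ _ h h' => Prod.ext (hρu h.1 h'.1) (hσu h.2 h'.2), fun q => ?_, fun s => ?_⟩
  · obtain ⟨p, hp⟩ := hρt q.1
    obtain ⟨p', hp'⟩ := hσt q.2
    exact ⟨(p, p'), hp, hp'⟩
  · obtain ⟨a, ha⟩ := hρ s.1
    obtain ⟨b, hb⟩ := hσ s.2
    exact ⟨(a, b), fun p q h => ⟨ha _ _ h.1, hb _ _ h.2⟩⟩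

theorem wreath_right [Nonempty W.State] (h : U.Covers W) (Z : TransSgp.{u}) :
    (Z.wreath U).Covers (Z.wreath W) := by
  obtain ⟨ρ, hu, ht, hρ⟩ := h
  refine ⟨fun p q => p.1 = q.1 ∧ ρ p.2 q.2, fun _ _ _ h h' =>
    Prod.ext (h.1.symm.trans h'.1) (hu h.2 h'.2), fun q => ?_, fun s => ?_⟩
  · exact (ht q.2).elim fun p hp => ⟨(q.1, p), rfl, hp⟩
  · obtain ⟨a, ha⟩ := hρ s.snd
    refine ⟨⟨fun p => s.fst (Classical.epsilon (ρ p)), a⟩, fun p q ⟨h₁, h₂⟩ => ⟨?_, ha _ _ h₂⟩⟩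
    have hε : Classical.epsilon (ρ p.2) = q.2 := hu (Classical.epsilon_spec ⟨q.2, h₂⟩) h₂
    change Z.act p.1 (s.fst (Classical.epsilon (ρ p.2))) = Z.act q.1 (s.fst q.2)
    rw [hε, h₁]

end Covers

theorem wreath_prod_covers_prod_left (Z V W : TransSgp.{u}) :
    (Z.wreath (V.prod W)).Covers ((Z.wreath V).prod W) :=
  .of_surjective (fun p => ((p.1, p.2.1), p.2.2)) (fun q => ⟨(q.1.1, q.1.2, q.2), rfl⟩)
    fun s => ⟨⟨fun p => s.1.fst p.1, s.1.snd, s.2⟩, fun _ => rfl⟩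

theorem wreath_prod_covers_prod_right (Z V W : TransSgp.{u}) :
    (Z.wreath (V.prod W)).Covers (V.prod (Z.wreath W)) :=
  .of_surjective (fun p => (p.2.1, p.1, p.2.2)) (fun q => ⟨(q.2.1, q.1, q.2.2), rfl⟩)
    fun s => ⟨⟨fun p => s.2.fst p.2, s.1, s.2.snd⟩, fun _ => rfl⟩

theorem ofGroup_prod_wreath_prod_covers (G H : Type u) [Group G] [Group H] (V W : TransSgp.{u}) :
    ((ofGroup (G × H)).wreath (V.prod W)).Covers
      (((ofGroup G).wreath V).prod ((ofGroup H).wreath W)) :=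
  .of_surjective (fun p => ((p.1.1, p.2.1), p.1.2, p.2.2))
    (fun q => ⟨((q.1.1, q.2.1), q.1.2, q.2.2), rfl⟩)
    fun s => ⟨⟨fun p => (s.1.fst p.1, s.2.fst p.2), s.1.snd, s.2.snd⟩, fun _ => rfl⟩

theorem covers_trivial_prod (W : TransSgp.{u}) : W.Covers (trivial.prod W) :=
  .of_surjective (fun q => (PUnit.unit, q)) (fun q => ⟨q.2, rfl⟩) fun s => ⟨s.2, fun _ => rfl⟩

theorem covers_prod_trivial (W : TransSgp.{u}) : W.Covers (W.prod trivial) :=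
  .of_surjective (fun q => (q, PUnit.unit)) (fun q => ⟨q.1, rfl⟩) fun s => ⟨s.1, fun _ => rfl⟩

/-- The action of a semigroup on states, extended to the semigroup with an identity adjoined. -/
def actOne (W : TransSgp.{u}) (q : W.State) (m : WithOne W.Sgp) : W.State :=
  m.recOneCoe q (W.act q)

/-- The hypotheses say that `B` contains the regular representation of the direct power
`W.State → V.Sgp`, the empty word corresponding to `b₀`. -/
theorem wreath_ofSemigroup_covers {B : TransSgp.{u}} (b₀ : B.State)
    (κ : (W.State → V.Sgp) → B.State) (hκ : Function.Injective κ)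
    (lift : (W.State → V.Sgp) → B.Sgp) (act_base : ∀ F, B.act b₀ (lift F) = κ F)
    (act_lift : ∀ F F', B.act (κ F) (lift F') = κ (F * F')) :
    (B.wreath (ofSemigroup W.Sgp)).Covers (ofSemigroup (WreathSgp V W)) := by
  let j : WithOne (WreathSgp V W) → B.State × WithOne W.Sgp := fun r =>
    r.recOneCoe (b₀, 1) fun a => (κ a.fst, (a.snd : WithOne W.Sgp))
  have hj : Function.Injective j := by
    intro r r' h
    induction r using WithOne.recOneCoe <;> induction r' using WithOne.recOneCoe
    · rfl
    · exact absurd (congrArg Prod.snd h) WithOne.one_ne_coe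
    · exact absurd (congrArg Prod.snd h) WithOne.coe_ne_one
    · exact congrArg _ (WreathSgp.ext (hκ (congrArg Prod.fst h))
        (WithOne.coe_inj.1 (congrArg Prod.snd h)))
  refine .of_injective j hj fun s : WreathSgp V W =>
    ⟨⟨fun m => lift fun q => s.fst (W.actOne q m), s.snd⟩, fun r => ?_⟩
  induction r using WithOne.recOneCoe
  · refine Eq.trans ?_ (congrArg j (one_mul (s : WithOne (WreathSgp V W))).symm)
    exact Prod.ext (act_base s.fst) (one_mul (s.snd : WithOne W.Sgp))
  · exact Prod.ext (act_lift _ _) rfl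

theorem ofSemigroup_covers_of_divides {S T : Type u} [Semigroup S] [Semigroup T]
    (h : Divides S T) : (ofSemigroup T).Covers (ofSemigroup S) := by
  obtain ⟨K, f, hf⟩ := h
  let incl : WithOne K →* WithOne T := WithOne.mapMulHom (MulMemClass.subtype K)
  have hTK : (ofSemigroup T).Covers (ofSemigroup K) :=
    .of_injective incl (WithOne.mapMulHom_injective Subtype.val_injective) fun u : K =>
      ⟨u.1, fun q : WithOne K => (map_mul incl q u).symm⟩
  have hf_surj : Function.Surjective (WithOne.mapMulHom f) := fun s =>
    s.recOneCoe ⟨1, rfl⟩ fun s => (hf s).elim fun u hu => ⟨u, congrArg _ hu⟩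
  refine hTK.trans (.of_surjective (WithOne.mapMulHom f) hf_surj fun s : S => ?_)
  obtain ⟨u, rfl⟩ := hf s
  exact ⟨u, fun q : WithOne K => map_mul (WithOne.mapMulHom f) q u⟩

/-- A transformation semigroup is faithful if its elements are determined by their action. -/
def IsFaithful (W : TransSgp.{u}) : Prop :=
  ∀ s t, (∀ q, W.act q s = W.act q t) → s = t

theorem isFaithful_ofGroup (G : Type u) [Group G] : (ofGroup G).IsFaithful :=
  fun _ _ h => mul_left_cancel (G := G) (h (1 : G))

theorem isFaithful_ofSemigroup (S : Type u) [Semigroup S] : (ofSemigroup S).IsFaithful :=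
  fun s t h => WithOne.coe_inj.1 <| by
    simpa only [ofSemigroup, one_mul] using h (1 : WithOne S)

namespace IsFaithful

theorem wreath [Nonempty V.State] (hV : V.IsFaithful) (hW : W.IsFaithful) :
    (V.wreath W).IsFaithful := fun _ _ h =>
  WreathSgp.ext (funext fun q => hV _ _ fun p => congrArg Prod.fst (h (p, q)))
    (hW _ _ fun q => congrArg Prod.snd (h (Classical.arbitrary V.State, q)))

theorem prod [Nonempty V.State] [Nonempty W.State] (hV : V.IsFaithful) (hW : W.IsFaithful) :
    (V.prod W).IsFaithful := fun _ _ h =>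
  Prod.ext (hV _ _ fun p => congrArg Prod.fst (h (p, Classical.arbitrary W.State)))
    (hW _ _ fun q => congrArg Prod.snd (h (Classical.arbitrary V.State, q)))

end IsFaithful

theorem Covers.divides (h : V.Covers W) (hW : W.IsFaithful) : Divides W.Sgp V.Sgp := by
  obtain ⟨ρ, hu, ht, hρ⟩ := h
  let K : Subsemigroup V.Sgp :=
    { carrier := {a | ∃ s, ∀ p q, ρ p q → ρ (V.act p a) (W.act q s)}
      mul_mem' := fun {a b} ⟨s, hs⟩ ⟨t, ht⟩ => ⟨s * t, fun p q h => by
        rw [V.act_mul, W.act_mul]; exact ht _ _ (hs _ _ h)⟩ }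
  choose φ hφ using fun a : K => a.2
  have hφ_unique {a : K} {s : W.Sgp} (hs : ∀ p q, ρ p q → ρ (V.act p a) (W.act q s)) : φ a = s :=
    hW _ _ fun q => (ht q).elim fun p hp => hu (hφ a p q hp) (hs p q hp)
  refine ⟨K, ⟨φ, fun a b => hφ_unique fun p q h => ?_⟩, fun s => ?_⟩
  · rw [W.act_mul]
    exact (V.act_mul p a b).symm ▸ hφ b _ _ (hφ a p q h)
  · obtain ⟨a, ha⟩ := hρ s
    exact ⟨⟨a, s, ha⟩, hφ_unique ha⟩

end TransSgp

/-! ## Iterated wreath products and complexity -/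

open TransSgp

instance (G : Type u) [Group G] [Finite G] : Finite (ofGroup G).Sgp := ‹Finite G›

instance (A : Type u) [Semigroup A] [Finite A] : Finite (ofSemigroup A).Sgp := ‹Finite A›

instance (A : Type u) [Semigroup A] [Finite A] : Finite (ofSemigroup A).State :=
  inferInstanceAs (Finite (Option A))

instance (V W : TransSgp.{u}) [Finite W.State] [Finite V.Sgp] [Finite W.Sgp] :
    Finite (WreathSgp V W) :=
  Finite.of_injective (fun s : WreathSgp V W => (s.fst, s.snd)) fun _ _ h =>
    WreathSgp.ext (congrArg Prod.fst h) (congrArg Prod.snd h)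

instance (S : Type u) [Semigroup S] : Nonempty (ofSemigroup S).State := ⟨(1 : WithOne S)⟩

instance (G : Type u) [Group G] : Nonempty (ofGroup G).State := ⟨(1 : G)⟩

instance (V W : TransSgp.{u}) [Nonempty V.State] [Nonempty W.State] :
    Nonempty (V.prod W).State :=
  inferInstanceAs (Nonempty (V.State × W.State))

instance (V W : TransSgp.{u}) [Nonempty V.State] [Nonempty W.State] :
    Nonempty (V.wreath W).State :=
  inferInstanceAs (Nonempty (V.State × W.State))

namespace IsWreathProduct

variable {m n : ℕ} {V W : TransSgp.{u}}

theorem nonempty_state (h : IsWreathProduct n W) : Nonempty W.State := by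
  induction h with
  | trivial => exact inferInstanceAs (Nonempty PUnit)
  | group _ G W _ ih => infer_instance
  | aperiodic _ A W _ _ ih => infer_instance

theorem finite_state (h : IsWreathProduct n W) : Finite W.State := by
  induction h with
  | trivial => exact inferInstanceAs (Finite PUnit)
  | group _ G W _ ih => exact inferInstanceAs (Finite (G × W.State))
  | aperiodic _ A W _ _ ih => exact inferInstanceAs (Finite ((ofSemigroup A).State × W.State))

theorem finite_sgp (h : IsWreathProduct n W) : Finite W.Sgp := by
  induction h with
  | trivial => exact inferInstanceAs (Finite PUnit)
  | group _ G W h ih =>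
    have := h.finite_state
    exact inferInstanceAs (Finite (WreathSgp (ofGroup G) W))
  | aperiodic _ A W _ h ih =>
    have := h.finite_state
    exact inferInstanceAs (Finite (WreathSgp (ofSemigroup A) W))

theorem exists_covers_prod (hV : IsWreathProduct m V) (hW : IsWreathProduct n W) :
    ∃ l ≤ max m n, ∃ U, IsWreathProduct l U ∧ U.Covers (V.prod W) := by
  induction hV generalizing n W with
  | trivial => exact ⟨n, le_max_right _ _, W, hW, covers_trivial_prod W⟩
  | aperiodic m A V hA hV ihV =>
    have := hV.nonempty_state
    have := hW.nonempty_state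
    obtain ⟨l, hl, U, hU, hUVW⟩ := ihV hW
    exact ⟨l, hl, _, hU.aperiodic l A U hA,
      (hUVW.wreath_right _).trans (wreath_prod_covers_prod_left _ V W)⟩
  | group m G V hV ihV =>
    have := hV.nonempty_state
    induction hW with
    | trivial =>
      exact ⟨m + 1, le_max_left _ _, _, hV.group m G V, covers_prod_trivial _⟩
    | aperiodic n A W hA hW ihW =>
      have := hW.nonempty_state
      obtain ⟨l, hl, U, hU, hUVW⟩ := ihW
      exact ⟨l, hl, _, hU.aperiodic l A U hA,
        (hUVW.wreath_right _).trans (wreath_prod_covers_prod_right _ _ W)⟩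
    | group n H W hW _ =>
      have := hW.nonempty_state
      obtain ⟨l, hl, U, hU, hUVW⟩ := ihV hW
      exact ⟨l + 1, by omega, _, hU.group l (G × H) U,
        (hUVW.wreath_right _).trans (ofGroup_prod_wreath_prod_covers G H V W)⟩

theorem exists_covers_ofSemigroup (hW : IsWreathProduct n W) :
    ∃ U, IsWreathProduct n U ∧ U.Covers (ofSemigroup W.Sgp) := by
  induction hW with
  | trivial =>
    exact ⟨_, .aperiodic 0 PUnit _ isAperiodic_punit .trivial,
      .of_surjective Prod.fst (fun q => ⟨(q, PUnit.unit), rfl⟩)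
        fun s => ⟨⟨fun _ => s, PUnit.unit⟩, fun _ => rfl⟩⟩
  | group n G W hW ih =>
    have := hW.finite_state
    obtain ⟨U, hU, hUW⟩ := ih
    exact ⟨_, hU.group n (W.State → G) U, (hUW.wreath_right _).trans <|
      wreath_ofSemigroup_covers (V := ofGroup G) (B := ofGroup (W.State → G)) (1 : W.State → G) id
        Function.injective_id id (one_mul (M := W.State → G)) fun _ _ => rfl⟩
  | aperiodic n A W hA hW ih =>
    have := hW.finite_state
    obtain ⟨U, hU, hUW⟩ := ih
    exact ⟨_, hU.aperiodic n (W.State → A) U (hA.pi _), (hUW.wreath_right _).trans <|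
      wreath_ofSemigroup_covers (V := ofSemigroup A) (B := ofSemigroup (W.State → A))
        (1 : WithOne (W.State → A)) WithOne.coe WithOne.coe_injective id
        (fun F : W.State → A => one_mul (F : WithOne (W.State → A))) fun _ _ => rfl⟩

theorem exists_isAperiodicHom (hW : IsWreathProduct n W) (hn : n ≤ m + 1) :
    ∃ (H : Type u) (_ : Group H) (_ : Finite H) (l : ℕ) (V : TransSgp.{u}), l ≤ m ∧
      IsWreathProduct l V ∧ ∃ π : W.Sgp →ₙ* WreathSgp (ofGroup H) V, IsAperiodicHom π := by
  induction hW with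
  | trivial =>
    exact ⟨PUnit, inferInstance, inferInstance, 0, TransSgp.trivial, Nat.zero_le m, .trivial,
      ⟨fun _ => ⟨fun _ => PUnit.unit, PUnit.unit⟩, fun _ _ => rfl⟩,
      fun _ _ _ _ => MaxSubgroup.elt_injective rfl⟩
  | group n G W hW _ =>
    exact ⟨G, inferInstance, inferInstance, n, W, by omega, hW, MulHom.id _,
      .of_injective Function.injective_id⟩
  | aperiodic n A W hA _ ih =>
    obtain ⟨H, iG, iF, l, V, hl, hV, π, hπ⟩ := ih hn
    exact ⟨H, iG, iF, l, V, hl, hV, π.comp (sndHom (ofSemigroup A) W),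
      hπ.comp (isAperiodicHom_sndHom (V := ofSemigroup A) hA)⟩

end IsWreathProduct

theorem Divides.refl (S : Type u) [Semigroup S] : Divides S S :=
  ⟨⊤, MulMemClass.subtype ⊤, fun s => ⟨⟨s, Subsemigroup.mem_top s⟩, rfl⟩⟩

namespace ComplexityLe

variable {k : ℕ} {S T : Type u} [Semigroup S] [Semigroup T]

theorem exists_covers (h : ComplexityLe k S) :
    ∃ n ≤ k, ∃ V, IsWreathProduct n V ∧ V.Covers (ofSemigroup S) := by
  obtain ⟨n, W, hn, hW, hS⟩ := h
  obtain ⟨V, hV, hVW⟩ := hW.exists_covers_ofSemigroup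
  exact ⟨n, hn, V, hV, hVW.trans (ofSemigroup_covers_of_divides hS)⟩

theorem of_covers {n : ℕ} {V W : TransSgp.{u}} (hn : n ≤ k) (hV : IsWreathProduct n V)
    (h : V.Covers W) (hW : W.IsFaithful) : ComplexityLe k W.Sgp :=
  ⟨n, V, hn, hV, h.divides hW⟩

theorem punit (k : ℕ) : ComplexityLe k PUnit.{u + 1} :=
  ⟨0, TransSgp.trivial, Nat.zero_le k, .trivial, .refl _⟩

theorem prod (hS : ComplexityLe k S) (hT : ComplexityLe k T) : ComplexityLe k (S × T) := by
  obtain ⟨m, hm, V, hV, hVS⟩ := hS.exists_covers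
  obtain ⟨n, hn, W, hW, hWT⟩ := hT.exists_covers
  obtain ⟨l, hl, U, hU, hUVW⟩ := hV.exists_covers_prod hW
  exact of_covers (W := (ofSemigroup S).prod (ofSemigroup T)) (hl.trans (max_le hm hn)) hU
    (hUVW.trans (hVS.prod hWT)) ((isFaithful_ofSemigroup S).prod (isFaithful_ofSemigroup T))

theorem wreath_ofGroup (hS : ComplexityLe k S) (H : Type u) [Group H] [Finite H] :
    ComplexityLe (k + 1) (WreathSgp (ofGroup H) (ofSemigroup S)) := by
  obtain ⟨n, hn, V, hV, hVS⟩ := hS.exists_covers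
  exact of_covers (W := (ofGroup H).wreath (ofSemigroup S)) (Nat.succ_le_succ hn) (hV.group n H V)
    (hVS.wreath_right _) ((isFaithful_ofGroup H).wreath (isFaithful_ofSemigroup S))

theorem exists_isAperiodicHom (hT : ComplexityLe (k + 1) T) :
    ∃ (H : Type u) (_ : Group H) (_ : Finite H) (l : ℕ) (V : TransSgp.{u}), l ≤ k ∧
      IsWreathProduct l V ∧ ∃ (U : Type u) (_ : Semigroup U) (_ : Finite U) (φ : U →ₙ* T)
        (π : U →ₙ* WreathSgp (ofGroup H) V), Function.Surjective φ ∧ IsAperiodicHom π := by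
  obtain ⟨n, W, hn, hW, K, φ, hφ⟩ := hT
  have := hW.finite_sgp
  obtain ⟨H, iG, iF, l, V, hl, hV, π, hπ⟩ := hW.exists_isAperiodicHom hn
  exact ⟨H, iG, iF, l, V, hl, hV, K, inferInstance, inferInstance, φ,
    π.comp (MulMemClass.subtype K), hφ, hπ.comp (.of_injective Subtype.val_injective)⟩

end ComplexityLe

/-! ## Flows bound pointlike sets -/

section FlowTransducer

/-- The set `Z` of elements of the maximal subgroup at `e` is pointlike with respect to `C_k`, as a
subset of `S`. -/
def IsGroupPointlike {S : Type u} [Semigroup S] {e : S} {he : IsIdempotentElem e} (k : ℕ)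
    (Z : Set (MaxSubgroup he)) : Prop :=
  IsPointlike k {s | ∃ g ∈ Z, s = g.elt}

namespace SetPartition

variable {α : Type u} (P : SetPartition α)

/-- The class of an element under a set-partition; it is empty outside the underlying set. -/
def cls (y : α) : Set α := {z | P.rel y z}

variable {P}

theorem cls_eq_cls_iff {y z : α} (hz : z ∈ P.carrier) : P.cls y = P.cls z ↔ P.rel y z := by
  refine ⟨fun h => ?_, fun h => Set.ext fun x => ⟨P.trans _ _ _ (P.symm _ _ h), P.trans _ _ _ h⟩⟩
  have hmem : z ∈ P.cls z := hz
  rwa [← h] at hmem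

end SetPartition

theorem exists_perm_apply_eq {α I : Type*} [Finite α] {a b : I → α}
    (h : ∀ i j, a i = a j ↔ b i = b j) : ∃ σ : Equiv.Perm α, ∀ i, σ (a i) = b i := by
  classical
  have := Fintype.ofFinite α
  let c : Set.range a → α := fun x => b x.2.choose
  have hc (i) : c ⟨a i, i, rfl⟩ = b i :=
    (h _ i).1 (Exists.choose_spec (⟨i, rfl⟩ : a i ∈ Set.range a))
  have hinj : Function.Injective c := by
    rintro ⟨_, i, rfl⟩ ⟨_, j, rfl⟩ hij
    rw [hc, hc] at hij
    exact Subtype.ext ((h i j).2 hij)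
  exact ⟨(Equiv.ofInjective c hinj).extendSubtype, fun i =>
    ((Equiv.ofInjective c hinj).extendSubtype_apply_of_mem (a i) ⟨i, rfl⟩).trans (hc i)⟩

namespace Automaton

variable {X : Type u} (A : Automaton X)

instance : Finite A.Sgp :=
  have : Finite (Function.End (Option A.State))ᵐᵒᵖ :=
    .of_equiv (Option A.State → Option A.State) MulOpposite.opEquiv
  inferInstance

/-- The letter `x` as an element of the transformation semigroup of `A`. -/
def gen (x : X) : A.Sgp := ⟨A.letter x, Subsemigroup.subset_closure ⟨x, rfl⟩⟩

/-- The state reached from `q` under an element of the transformation semigroup or the identity;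
`none` is the sink. -/
def run (q : Option A.State) (m : WithOne A.Sgp) : Option A.State :=
  (WithOne.lift (MulMemClass.subtype (Subsemigroup.closure (Set.range A.letter))) m).unop q

theorem run_one (q : Option A.State) : A.run q 1 = q := by
  rw [run, map_one]; rfl

theorem run_mul (q : Option A.State) (m n : WithOne A.Sgp) :
    A.run q (m * n) = A.run (A.run q m) n := by
  rw [run, map_mul]; rfl

theorem completion_step (q : Option A.State) (x : X) :
    A.completion.step q x = some (A.run q (A.gen x)) := rfl

end Automaton

variable {M : Type u} [Semigroup M] {e : M} {he : IsIdempotentElem e} {X : Type u} {ι : X → M}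
  {A : Automaton X}

theorem IsFlow.exists_perm [Finite M] {f : A.State → SetPartition (RClass e)}
    (hf : IsFlow he ι A f) {q q' : A.State} {x : X} (hq : A.step q x = some q') :
    ∃ σ : Equiv.Perm (Set (RClass e)), ∀ y z : RClass e, y ∈ (f q).carrier → (z : M) = y * ι x →
      σ ((f q').cls z) = (f q).cls y := by
  obtain ⟨σ, hσ⟩ := exists_perm_apply_eq
    (I := {p : RClass e × RClass e // p.1 ∈ (f q).carrier ∧ (p.2 : M) = p.1 * ι x})
    (a := fun p => (f q').cls p.1.2) (b := fun p => (f q).cls p.1.1) <| by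
      rintro ⟨⟨y, z⟩, hy, hz⟩ ⟨⟨y', z'⟩, hy', hz'⟩
      rw [SetPartition.cls_eq_cls_iff (hf.mapsTo q x q' hq _ _ hy' hz'),
        SetPartition.cls_eq_cls_iff hy']
      exact (hf.injective q x q' hq y y' z z' hy hy' hz hz').symm
  exact ⟨σ, fun y z hy hz => hσ ⟨(y, z), hy, hz⟩⟩

/-- The element of the wreath product of a power of `Perm P` and the transformation semigroup of
`A` that records, along with the letter `x`, the permutations `σ q x` attached to its transitions:
the permutation of a word started at `m` is indexed by the possible initial states `q`. -/
def transducer {P : Type u} (σ : Option A.State → X → Equiv.Perm P) (x : X) :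
    WreathSgp (ofGroup (Option A.State → Equiv.Perm P)) (ofSemigroup A.Sgp) :=
  ⟨fun m q => σ (A.run q m) x, A.gen x⟩

theorem IsFlow.cls_eq_of_rel_transducer {F : A.completion.State → SetPartition (RClass e)}
    (hF : IsFlow he ι A.completion F) (hι : Subsemigroup.closure (Set.range ι) = ⊤)
    {σ : Option A.State → X → Equiv.Perm (Set (RClass e))}
    (hσ : ∀ q x, ∀ y z : RClass e, y ∈ (F q).carrier → (z : M) = y * ι x →
      σ q x ((F (A.run q (A.gen x))).cls z) = (F q).cls y)
    {p : M × WreathSgp _ _} (hp : (RelMorphism.ofGenerators ι (transducer σ) hι).rel p.1 p.2)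
    (q : Option A.State) (n : WithOne A.Sgp) (y z : RClass e)
    (hy : y ∈ (F (A.run q n)).carrier) (hz : (z : M) = y * p.1) :
    z ∈ (F (A.run q ((ofSemigroup A.Sgp).act n p.2.snd))).carrier ∧
      p.2.fst n q ((F (A.run q ((ofSemigroup A.Sgp).act n p.2.snd))).cls z) =
        (F (A.run q n)).cls y := by
  change p ∈ Subsemigroup.closure _ at hp
  induction hp using Subsemigroup.closure_induction generalizing n y z with
  | mem p hp =>
    obtain ⟨x, rfl⟩ := hp
    change z ∈ (F (A.run q (n * A.gen x))).carrier ∧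
      σ (A.run q n) x ((F (A.run q (n * A.gen x))).cls z) = _
    rw [A.run_mul]
    exact ⟨hF.mapsTo _ x _ (A.completion_step _ x) y z hy hz, hσ _ x y z hy hz⟩
  | mul p p' _ _ ih ih' =>
    have hz' : (z : M) = y * p.1 * p'.1 := by rw [hz, Prod.fst_mul, mul_assoc]
    have hyp : (y : M) * p.1 ∈ RClass e := mem_rClass_of_mul_mem he
      (by rw [← mul_assoc, idem_mul_of_mem_rClass he y.2]) (hz' ▸ z.2)
    obtain ⟨hmid, hcls⟩ := ih n y ⟨_, hyp⟩ hy rfl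
    obtain ⟨hend, hcls'⟩ := ih' ((ofSemigroup A.Sgp).act n p.2.snd) ⟨_, hyp⟩ z hmid hz'
    have hact := (ofSemigroup A.Sgp).act_mul n p.2.snd p'.2.snd
    exact hact ▸ ⟨hend, (congrArg (p.2.fst n q) hcls').trans hcls⟩

theorem AdmitsFlow.subsingleton_of_isGroupPointlike [Finite M]
    (hι : Subsemigroup.closure (Set.range ι) = ⊤) {k : ℕ} (h : AdmitsFlow he ι k)
    {Z : Set (MaxSubgroup he)} (hZ : IsGroupPointlike (k + 1) Z) :
    Z.Subsingleton := by
  obtain ⟨A, hA, f, ⟨-, hF, hcover⟩, -⟩ := h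
  choose σ hσ using fun q x => hF.exists_perm (A.completion_step q x)
  obtain ⟨t, ht⟩ := hZ _ (hA.wreath_ofGroup _) (.ofGenerators ι (transducer σ) hι)
  obtain ⟨q, hq⟩ := hcover ⟨e, idem_mem_rClass e⟩
  have hcls {g : MaxSubgroup he} (hg : g ∈ Z) := hF.cls_eq_of_rel_transducer hι hσ
    (p := (g.elt, t)) (ht _ ⟨g, hg, rfl⟩) (some q) 1 ⟨e, idem_mem_rClass e⟩
    ⟨g.elt, g.elt_mem_rClass⟩ (by rwa [A.run_one]) g.idem_mul_elt.symm
  intro g hg g' hg'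
  have heq := (t.fst (1 : WithOne A.Sgp) (some q)).injective ((hcls hg).2.trans (hcls hg').2.symm)
  rw [SetPartition.cls_eq_cls_iff (hcls hg').1] at heq
  have := hF.crossSection _ _ _ heq ⟨g' * g⁻¹, by
    rw [MaxSubgroup.elt_mul, mul_assoc, MaxSubgroup.elt_inv_mul_elt, MaxSubgroup.elt_mul_idem]⟩
  exact MaxSubgroup.elt_injective (congrArg Subtype.val this)

end FlowTransducer

/-! ## Flows from relational morphisms -/

section Separation

variable {S T T' U : Type u} [Semigroup S] [Semigroup T] [Semigroup T'] [Semigroup U]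

namespace RelMorphism

/-- The relational morphism to a product with the given components. -/
def prod (r : RelMorphism S T) (r' : RelMorphism S T') : RelMorphism S (T × T') where
  rel s t := r.rel s t.1 ∧ r'.rel s t.2
  total s := by
    obtain ⟨⟨t, ht⟩, t', ht'⟩ := And.intro (r.total s) (r'.total s)
    exact ⟨(t, t'), ht, ht'⟩
  mul _ _ _ _ h h' := ⟨r.mul _ _ _ _ h.1 h'.1, r'.mul _ _ _ _ h.2 h'.2⟩

/-- The relational morphism to `U` obtained by lifting along a surjection `φ : U →ₙ* T`. -/
def lift (r : RelMorphism S T) (φ : U →ₙ* T) (hφ : Function.Surjective φ) : RelMorphism S U where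
  rel s u := r.rel s (φ u)
  total s := by
    obtain ⟨t, ht⟩ := r.total s
    obtain ⟨u, rfl⟩ := hφ t
    exact ⟨u, ht⟩
  mul _ _ _ _ h h' := by rw [map_mul]; exact r.mul _ _ _ _ h h'

/-- The composite of a relational morphism with a homomorphism. -/
def comp (r : RelMorphism S T) (π : T →ₙ* U) : RelMorphism S U where
  rel s u := ∃ t, r.rel s t ∧ π t = u
  total s := by
    obtain ⟨t, ht⟩ := r.total s
    exact ⟨π t, t, ht, rfl⟩
  mul := by
    rintro s _ s' _ ⟨t, ht, rfl⟩ ⟨t', ht', rfl⟩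
    exact ⟨t * t', r.mul _ _ _ _ ht ht', map_mul π t t'⟩

/-- No non-trivial subgroup of the maximal subgroup at `e` is related to a single element. -/
def SeparatesSubgroups (r : RelMorphism S T) {e : S} (he : IsIdempotentElem e) : Prop :=
  ∀ (P : Subgroup (MaxSubgroup he)) (t : T), (∀ g ∈ P, r.rel g.elt t) → P = ⊥

theorem SeparatesSubgroups.eq_one_of_comp_rel [Finite S] [Finite T] {r : RelMorphism S T} {e : S}
    {he : IsIdempotentElem e} (hr : r.SeparatesSubgroups he) {π : T →ₙ* U}
    (hπ : IsAperiodicHom π) {f : U} (hf : IsIdempotentElem f) (hef : (r.comp π).rel e f)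
    {a : MaxSubgroup he} (haf : (r.comp π).rel a.elt f) : a = 1 := by
  let Q : Submonoid (MaxSubgroup he) :=
    { carrier := {b | (r.comp π).rel b.elt f}
      one_mem' := hef
      mul_mem' := fun hb hc => by
        have := (r.comp π).mul _ _ _ _ hb hc
        rwa [hf.eq] at this }
  have hQ : ∀ b ∈ Subgroup.zpowers a, b ∈ Q := by
    intro b hb
    obtain ⟨n, rfl⟩ := mem_powers_iff_mem_zpowers.2 hb
    exact Q.pow_mem haf n
  let K : Subsemigroup T :=
    { carrier := {t | π t = f}
      mul_mem' := fun {b c} hb hc => by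
        rw [Set.mem_ofPred_eq, map_mul, hb, hc, hf.eq] }
  have hK : IsAperiodic K := hπ.isAperiodic_of_forall_eq fun _ ht => ht
  obtain ⟨u, hu⟩ := hK.exists_forall_rel (P := Subgroup.zpowers a)
    { rel := fun b u => r.rel b.1.elt u
      total := fun b => by
        obtain ⟨t, ht, htf⟩ := hQ b b.2
        exact ⟨⟨t, htf⟩, ht⟩
      mul := fun _ _ _ _ h h' => r.mul _ _ _ _ h h' }
  exact Subgroup.zpowers_eq_bot.1 (hr _ u fun b hb => hu ⟨b, hb⟩)

end RelMorphism

theorem exists_relMorphism_of_not_isPointlike {k : ℕ} {F : Set (Set S)} (hF : F.Finite)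
    (h : ∀ Z ∈ F, ¬ IsPointlike k Z) :
    ∃ (T : Type u) (_ : Semigroup T) (_ : Finite T), ComplexityLe k T ∧
      ∃ r : RelMorphism S T, ∀ Z ∈ F, ∀ t, ¬ ∀ s ∈ Z, r.rel s t := by
  induction F, hF using Set.Finite.induction_on with
  | empty =>
    exact ⟨PUnit, inferInstance, inferInstance, .punit k,
      ⟨fun _ _ => True, fun _ => ⟨PUnit.unit, trivial⟩, fun _ _ _ _ _ _ => trivial⟩,
      fun _ h => h.elim⟩
  | @insert Z F _ _ ih =>
    obtain ⟨T, _, _, hT, r, hr⟩ := ih fun Z hZ => h Z (Or.inr hZ)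
    have hZ := h Z (Or.inl rfl)
    simp only [IsPointlike, not_forall] at hZ
    obtain ⟨T', _, _, hT', r', hr'⟩ := hZ
    refine ⟨T × T', inferInstance, inferInstance, hT.prod hT', r.prod r', ?_⟩
    rintro Y (rfl | hY) t ht
    · exact hr' ⟨t.2, fun s hs => (ht s hs).2⟩
    · exact hr Y hY t.1 fun s hs => (ht s hs).1

theorem exists_separatesSubgroups [Finite S] {e : S} {he : IsIdempotentElem e} {k : ℕ}
    (h : ∀ P : Subgroup (MaxSubgroup he), IsGroupPointlike k (P : Set (MaxSubgroup he)) → P = ⊥) :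
    ∃ (T : Type u) (_ : Semigroup T) (_ : Finite T), ComplexityLe k T ∧
      ∃ r : RelMorphism S T, r.SeparatesSubgroups he := by
  obtain ⟨T, iT, fT, hT, r, hr⟩ := exists_relMorphism_of_not_isPointlike (k := k)
    (F := {Z | ∃ P : Subgroup (MaxSubgroup he), P ≠ ⊥ ∧ Z = {s | ∃ g ∈ P, s = g.elt}})
    (Set.toFinite _) (by rintro _ ⟨P, hP, rfl⟩ hPk; exact hP (h P hPk))
  refine ⟨T, iT, fT, hT, r, fun P t ht => ?_⟩
  by_contra hP
  exact hr _ ⟨P, hP, rfl⟩ t (by rintro _ ⟨g, hg, rfl⟩; exact ht g hg)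

end Separation

section WreathAction

variable {H : Type u} [Group H] {V : TransSgp.{u}}

instance : Group (ofGroup H).Sgp := inferInstanceAs (Group H)

/-- The group `V.State → H` acts on the left of the wreath product; its orbits are the fibres of the
projection to `V.Sgp`. -/
instance : MulAction (V.State → (ofGroup H).Sgp) (WreathSgp (ofGroup H) V) where
  smul d v := ⟨fun q => d q * v.fst q, v.snd⟩
  one_smul v := WreathSgp.ext (funext fun q => one_mul (v.fst q)) rfl
  mul_smul c d v := WreathSgp.ext (funext fun q => mul_assoc (c q) (d q) (v.fst q)) rfl

namespace TransSgp.WreathSgp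

theorem smul_mul (d : V.State → (ofGroup H).Sgp) (v w : WreathSgp (ofGroup H) V) :
    d • v * w = d • (v * w) :=
  WreathSgp.ext (funext fun q => mul_assoc (d q) (v.fst q) (w.fst (V.act q v.snd))) rfl

theorem exists_smul_eq {v w : WreathSgp (ofGroup H) V} (h : v.snd = w.snd) :
    ∃ d : V.State → (ofGroup H).Sgp, d • w = v :=
  ⟨fun q => v.fst q * (w.fst q)⁻¹,
    WreathSgp.ext (funext fun q => inv_mul_cancel_right (v.fst q) (w.fst q)) h.symm⟩

theorem exists_mul_eq {u v : WreathSgp (ofGroup H) V} {w : V.Sgp}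
    (h : v.snd = w * u.snd) : ∃ v' : WreathSgp (ofGroup H) V, v'.snd = w ∧ v' * u = v :=
  ⟨⟨fun q => v.fst q * (u.fst (V.act q w))⁻¹, w⟩, rfl,
    WreathSgp.ext (funext fun q => inv_mul_cancel_right (v.fst q) (u.fst (V.act q w))) h.symm⟩

end TransSgp.WreathSgp

end WreathAction

section LiftFlow

variable {M : Type u} [Semigroup M] {e : M} {he : IsIdempotentElem e}

theorem MaxSubgroup.mul_inv_elt_mul (g g' : MaxSubgroup he) (y : M) :
    (g * g'⁻¹).elt * (g'.elt * y) = g.elt * y := by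
  rw [elt_mul, mul_assoc, ← mul_assoc _ g'.elt, elt_inv_mul_elt, ← mul_assoc, elt_mul_idem]

namespace RelMorphism

variable {H : Type u} [Group H] {V : TransSgp.{u}} {r : RelMorphism M (WreathSgp (ofGroup H) V)}
  {f : WreathSgp (ofGroup H) V}

/-- `v` is a lift of `y`, an element of the `ℛ`-class of `e`, to an element below `f`. -/
structure IsLift (r : RelMorphism M (WreathSgp (ofGroup H) V)) (e : M)
    (f : WreathSgp (ofGroup H) V) (y : M) (v : WreathSgp (ofGroup H) V) : Prop where
  mem_rClass : y ∈ RClass e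
  rel : r.rel y v
  mul_eq : f * v = v

theorem IsLift.mul {y : M} {v : WreathSgp (ofGroup H) V} (h : r.IsLift e f y v) {m : M}
    {u : WreathSgp (ofGroup H) V} (hu : r.rel m u) (hm : y * m ∈ RClass e) :
    r.IsLift e f (y * m) (v * u) :=
  ⟨hm, r.mul _ _ _ _ h.rel hu, by rw [← mul_assoc, h.mul_eq]⟩

theorem IsLift.smul_idem (hf : r.IsMinimalOver e f) (a : MaxSubgroup he) {y : M}
    {v : WreathSgp (ofGroup H) V} {d : V.State → (ofGroup H).Sgp}
    (h : r.IsLift e f (a.elt * y) (d • v))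
    (hv : r.IsLift e f y v) : r.IsLift e f a.elt (d • f) := by
  -- a translate at `y` is brought back to `e` along a path that also brings its lift back to `f`
  obtain ⟨-, t, ht⟩ := (mem_rClass_iff he).1 hv.mem_rClass
  obtain ⟨t', τ, hτ, hyt, hvτ⟩ := hf.exists_return hv.rel hv.mul_eq ht he
  have hat : a.elt * y * t' = a.elt := by rw [mul_assoc, hyt, a.elt_mul_idem]
  have := h.mul hτ (hat.symm ▸ a.elt_mem_rClass)
  rwa [hat, WreathSgp.smul_mul, hvτ] at this

theorem IsLift.smul_of_idem {a : MaxSubgroup he} {d : V.State → (ofGroup H).Sgp}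
    (h : r.IsLift e f a.elt (d • f)) {y : M} {v : WreathSgp (ofGroup H) V}
    (hv : r.IsLift e f y v) : r.IsLift e f (a.elt * y) (d • v) := by
  have := h.mul hv.rel (a.elt_mul_mem_rClass hv.mem_rClass)
  rwa [WreathSgp.smul_mul, hv.mul_eq] at this

theorem IsLift.transport (hf : r.IsMinimalOver e f) {g g' : MaxSubgroup he} {z z' : M}
    {v v' : WreathSgp (ofGroup H) V} {d : V.State → (ofGroup H).Sgp}
    (h : r.IsLift e f (g.elt * z) (d • v))
    (hv : r.IsLift e f (g'.elt * z) v) (hv' : r.IsLift e f (g'.elt * z') v') :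
    r.IsLift e f (g.elt * z') (d • v') := by
  rw [← MaxSubgroup.mul_inv_elt_mul g g'] at h ⊢
  exact (IsLift.smul_idem hf _ h hv).smul_of_idem hv'

/-- The set-partition at the state `w`: two elements of the `ℛ`-class are equivalent if a left
translate of both has a common lift over `w`. -/
def liftPartition (he : IsIdempotentElem e) (hf : r.IsMinimalOver e f) (w : V.Sgp) :
    SetPartition (RClass e) where
  rel z z' := ∃ (g : MaxSubgroup he) (v : WreathSgp (ofGroup H) V), v.snd = w ∧
    r.IsLift e f (g.elt * z) v ∧ r.IsLift e f (g.elt * z') v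
  symm := by
    rintro z z' ⟨g, v, hv, hz, hz'⟩
    exact ⟨g, v, hv, hz', hz⟩
  trans := by
    rintro z z' z'' ⟨g, v, hv, hz, hz'⟩ ⟨g', v', hv', hz₁', hz''⟩
    obtain ⟨d, rfl⟩ := WreathSgp.exists_smul_eq (hv.trans hv'.symm)
    exact ⟨g, _, hv, hz, hz'.transport hf hz₁' hz''⟩

variable {hf : r.IsMinimalOver e f} {w : V.Sgp}

theorem isLift_mul_of_isLift {m : M} {u : WreathSgp (ofGroup H) V} (hu : r.rel m u)
    {g : MaxSubgroup he} {y z : RClass e} (hz : (z : M) = y * m) {v : WreathSgp (ofGroup H) V}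
    (h : r.IsLift e f (g.elt * y) v) : r.IsLift e f (g.elt * z) (v * u) := by
  have hz' : g.elt * (z : M) = g.elt * y * m := by rw [hz, mul_assoc]
  rw [hz']
  exact h.mul hu (hz' ▸ g.elt_mul_mem_rClass z.2)

theorem isLift_of_isLift_mul {m : M} {u : WreathSgp (ofGroup H) V} (hu : r.rel m u)
    {g : MaxSubgroup he} {y z : RClass e} (hz : (z : M) = y * m) {v : WreathSgp (ofGroup H) V}
    (hy : y ∈ (liftPartition he hf v.snd).carrier) (h : r.IsLift e f (g.elt * z) (v * u)) :
    r.IsLift e f (g.elt * y) v := by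
  obtain ⟨g', v', hv', hy', -⟩ := hy
  obtain ⟨d, rfl⟩ := WreathSgp.exists_smul_eq hv'.symm
  exact (WreathSgp.smul_mul d v' u ▸ h).transport hf (isLift_mul_of_isLift hu hz hy') hy'

theorem mem_carrier_liftPartition {m : M} {u : WreathSgp (ofGroup H) V} (hu : r.rel m u)
    {y z : RClass e} (hy : y ∈ (liftPartition he hf w).carrier) (hz : (z : M) = y * m) :
    z ∈ (liftPartition he hf (w * u.snd)).carrier := by
  obtain ⟨g, v, rfl, hv, -⟩ := hy
  exact ⟨g, v * u, rfl, isLift_mul_of_isLift hu hz hv, isLift_mul_of_isLift hu hz hv⟩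

theorem liftPartition_rel_iff {m : M} {u : WreathSgp (ofGroup H) V} (hu : r.rel m u)
    {y y' z z' : RClass e} (hy : y ∈ (liftPartition he hf w).carrier)
    (hy' : y' ∈ (liftPartition he hf w).carrier) (hz : (z : M) = y * m)
    (hz' : (z' : M) = y' * m) :
    (liftPartition he hf w).rel y y' ↔ (liftPartition he hf (w * u.snd)).rel z z' := by
  constructor
  · rintro ⟨g, v, rfl, hv, hv'⟩
    exact ⟨g, v * u, rfl, isLift_mul_of_isLift hu hz hv, isLift_mul_of_isLift hu hz' hv'⟩
  · rintro ⟨g, v, hv, hzv, hzv'⟩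
    obtain ⟨v, rfl, rfl⟩ := WreathSgp.exists_mul_eq hv
    exact ⟨g, v, rfl, isLift_of_isLift_mul hu hz hy hzv, isLift_of_isLift_mul hu hz' hy' hzv'⟩

theorem isCrossSection_liftPartition (h : ∀ a : MaxSubgroup he, r.rel a.elt f → a = 1) :
    IsCrossSection he (liftPartition he hf w) := by
  rintro y y' ⟨g, v, -, hy, hy'⟩ ⟨b, hb⟩
  have hgb : g.elt * (y' : M) = (g * b * g⁻¹).elt * (g.elt * y) := by
    rw [MaxSubgroup.mul_inv_elt_mul, hb, ← mul_assoc, MaxSubgroup.elt_mul]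
  have hlift : r.IsLift e f (g * b * g⁻¹).elt ((1 : V.State → (ofGroup H).Sgp) • f) :=
    .smul_idem hf _ (by rwa [one_smul, ← hgb]) hy
  have hb1 : b = 1 := conj_eq_one_iff.1 (h _ (one_smul (V.State → (ofGroup H).Sgp) f ▸ hlift.rel))
  exact Subtype.ext (by
    rw [hb, hb1, MaxSubgroup.elt_one, idem_mul_of_mem_rClass he y.2])

theorem isInvariant_liftPartition : IsInvariant he (liftPartition he hf w) := by
  rintro a y y' z z' hz hz' ⟨g, v, hv, hy, hy'⟩
  exact ⟨g * a⁻¹, v, hv, by rwa [hz, MaxSubgroup.mul_inv_elt_mul],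
    by rwa [hz', MaxSubgroup.mul_inv_elt_mul]⟩

theorem exists_mem_carrier_liftPartition (y : RClass e) :
    ∃ w, y ∈ (liftPartition he hf w).carrier := by
  obtain ⟨u, hu⟩ := r.total y
  have hlift : r.IsLift e f ((1 : MaxSubgroup he).elt * y) (f * u) :=
    IsLift.mul ⟨idem_mem_rClass e, hf.rel, hf.idem⟩ hu
      (by rw [idem_mul_of_mem_rClass he y.2]; exact y.2)
  exact ⟨_, 1, f * u, rfl, hlift, hlift⟩

end RelMorphism

/-- The automaton on a finite semigroup `T` in which the letter `x` acts by right multiplication by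
`t x`. -/
def rightMulAutomaton {T X : Type u} [Semigroup T] [Finite T] (t : X → T) : Automaton X where
  State := T
  step s x := some (s * t x)

theorem divides_sgp_rightMulAutomaton {T X : Type u} [Semigroup T] [Finite T] (t : X → T) :
    Divides (rightMulAutomaton t).Sgp T := by
  let φ : T →ₙ* (Function.End (Option T))ᵐᵒᵖ :=
    { toFun u := MulOpposite.op (Option.map (· * u))
      map_mul' u v := MulOpposite.unop_injective <| funext fun q => by
        cases q with
        | none => rfl
        | some s => exact congrArg some (mul_assoc s u v).symm }
  have hφ (x) : φ (t x) = (rightMulAutomaton t).letter x :=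
    MulOpposite.unop_injective (funext fun q => by cases q <;> rfl)
  have hrange : Subsemigroup.closure (Set.range (rightMulAutomaton t).letter) ≤ φ.srange :=
    Subsemigroup.closure_le.2 (Set.range_subset_iff.2 fun x => ⟨t x, hφ x⟩)
  refine ⟨_, φ.subsemigroupComap (.closure (Set.range (rightMulAutomaton t).letter)), ?_⟩
  rintro ⟨c, hc⟩
  obtain ⟨u, rfl⟩ := hrange hc
  exact ⟨⟨u, hc⟩, rfl⟩

variable {X : Type u} {ι : X → M}

theorem IsFlow.completion {A : Automaton X} {f : A.State → SetPartition (RClass e)}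
    (hf : IsFlow he ι A f) (hA : ∀ q x, (A.step q x).isSome) :
    IsFlow he ι A.completion (fun q : Option A.State => q.elim (.bottom _) f) where
  mapsTo := by
    rintro (_ | q) x _ ⟨⟩ y z hy hz
    · exact hy.elim
    · obtain ⟨q', hq'⟩ := Option.isSome_iff_exists.1 (hA q x)
      simp only [Option.bind_some, hq']
      exact hf.mapsTo q x q' hq' y z hy hz
  injective := by
    rintro (_ | q) x _ ⟨⟩ y y' z z' hy hy' hz hz'
    · exact hy.elim
    · obtain ⟨q', hq'⟩ := Option.isSome_iff_exists.1 (hA q x)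
      simp only [Option.bind_some, hq']
      exact hf.injective q x q' hq' y y' z z' hy hy' hz hz'
  crossSection := by
    rintro (_ | q)
    · exact fun _ _ h => h.elim
    · exact hf.crossSection q

theorem isFlow_liftPartition {H : Type u} [Group H] {V : TransSgp.{u}} [Finite V.Sgp]
    {r : RelMorphism M (WreathSgp (ofGroup H) V)} {f : WreathSgp (ofGroup H) V}
    (hf : r.IsMinimalOver e f) (h : ∀ a : MaxSubgroup he, r.rel a.elt f → a = 1)
    {v : X → WreathSgp (ofGroup H) V} (hv : ∀ x, r.rel (ι x) (v x)) :
    IsFlow he ι (rightMulAutomaton fun x => (v x).snd) (r.liftPartition he hf) where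
  mapsTo := by
    rintro w x _ ⟨⟩ y z hy hz
    exact RelMorphism.mem_carrier_liftPartition (hv x) hy hz
  injective := by
    rintro w x _ ⟨⟩ y y' z z' hy hy' hz hz'
    exact RelMorphism.liftPartition_rel_iff (hv x) hy hy' hz hz'
  crossSection _ := RelMorphism.isCrossSection_liftPartition h

theorem admitsFlow_of_forall_isGroupPointlike [Finite M] {k : ℕ} (ι : X → M)
    (h : ∀ P : Subgroup (MaxSubgroup he),
      IsGroupPointlike (k + 1) (P : Set (MaxSubgroup he)) → P = ⊥) :
    AdmitsFlow he ι k := by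
  obtain ⟨T, _, _, hT, r, hr⟩ := exists_separatesSubgroups h
  obtain ⟨H, _, _, l, V, hl, hV, U, _, _, φ, π, hφ, hπ⟩ := hT.exists_isAperiodicHom
  have := hV.finite_state
  have := hV.finite_sgp
  have hr' : (r.lift φ hφ).SeparatesSubgroups he := fun P u hP => hr P (φ u) hP
  let ψ := (r.lift φ hφ).comp π
  obtain ⟨f, hf⟩ := ψ.exists_isMinimalOver he
  choose v hv using fun x => ψ.total (ι x)
  have hflow := isFlow_liftPartition hf
    (fun _ => hr'.eq_one_of_comp_rel hπ hf.idem hf.rel) hv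
  exact ⟨_, ⟨l, V, hl, hV, divides_sgp_rightMulAutomaton _⟩, _,
    ⟨hflow, hflow.completion fun _ _ => rfl, RelMorphism.exists_mem_carrier_liftPartition⟩,
    fun _ => RelMorphism.isInvariant_liftPartition⟩

end LiftFlow

/-! ## The quotients `GM_J(G/N)` -/

section Quotients

variable {S : Type u} [Semigroup S] {e : S} {he : IsIdempotentElem e}
  {N : Subgroup (MaxSubgroup he)}

theorem MaxSubgroup.elt_mem_jClass (g : MaxSubgroup he) : g.elt ∈ JClass e := by
  have hge : JLe g.elt e := by simpa only [g.idem_mul_elt] using jLe_mul_right e g.elt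
  have heg : JLe e g.elt := by simpa only [g.elt_mul_elt_inv] using jLe_mul_right g.elt g⁻¹.elt
  exact ⟨hge, heg⟩

theorem MaxSubgroup.exists_elt_eq_of_mul_elt_mul [Finite S] {a b : S} {g m : MaxSubgroup he}
    (h : a * g.elt * b = m.elt) :
    (∃ u : MaxSubgroup he, a * e = u.elt) ∧ ∃ v : MaxSubgroup he, e * b = v.elt := by
  obtain ⟨q, hq⟩ := exists_elt_eq_of_mul_eq' he (a := g.elt * b * e) (b := m⁻¹.elt * a)
    (by rw [mul_assoc, ← mul_assoc, g.idem_mul_elt]) (by rw [mul_assoc, he.eq])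
    (by rw [← mul_assoc, mul_assoc _ a, ← mul_assoc a, h, elt_inv_mul_elt, he.eq])
  have ha : a * e = (m * q⁻¹).elt :=
    calc a * e = a * q.elt * q⁻¹.elt := by rw [mul_assoc, q.elt_mul_elt_inv]
      _ = a * g.elt * b * e * q⁻¹.elt := by rw [hq, ← mul_assoc, ← mul_assoc]
      _ = (m * q⁻¹).elt := by rw [h, m.elt_mul_idem, elt_mul]
  have hag : a * g.elt = (m * q⁻¹ * g).elt := by
    rw [elt_mul _ g, ← ha, mul_assoc, g.idem_mul_elt]
  refine ⟨⟨_, ha⟩, (m * q⁻¹ * g)⁻¹ * m, ?_⟩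
  rw [elt_mul, ← h, hag, ← mul_assoc, elt_inv_mul_elt]

/-- `x` is an element of the coset of `N` that contains `g`. -/
def InCoset (N : Subgroup (MaxSubgroup he)) (g : MaxSubgroup he) (x : S) : Prop :=
  ∃ h : MaxSubgroup he, g⁻¹ * h ∈ N ∧ x = h.elt

theorem InCoset.mul_elt_mul [Finite S] (hN : N.Normal) {g h : MaxSubgroup he} (hgh : g⁻¹ * h ∈ N)
    {a b : S} {m : MaxSubgroup he} (hm : InCoset N m (a * g.elt * b)) :
    InCoset N m (a * h.elt * b) := by
  obtain ⟨m', hmm', hm'⟩ := hm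
  obtain ⟨⟨u, hu⟩, v, hv⟩ := MaxSubgroup.exists_elt_eq_of_mul_elt_mul hm'
  have key (x : MaxSubgroup he) : a * x.elt * b = (u * x * v).elt :=
    calc a * x.elt * b = a * (e * x.elt * e) * b := by rw [x.idem_mul_elt, x.elt_mul_idem]
      _ = a * e * x.elt * (e * b) := by simp only [mul_assoc]
      _ = (u * x * v).elt := by rw [hu, hv, MaxSubgroup.elt_mul, MaxSubgroup.elt_mul]
  obtain rfl : u * g * v = m' := MaxSubgroup.elt_injective ((key g).symm.trans hm')
  refine ⟨u * h * v, ?_, key h⟩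
  have hconj := N.mul_mem hmm' (hN.conj_mem _ hgh v⁻¹)
  rwa [show m⁻¹ * (u * h * v) = m⁻¹ * (u * g * v) * (v⁻¹ * (g⁻¹ * h) * v⁻¹⁻¹) by group]

/-- The syntactic congruence of the family of cosets of `N`. -/
def syntacticCon (N : Subgroup (MaxSubgroup he)) : Con S where
  r s t := ∀ a b g, InCoset N g (a * s * b) ↔ InCoset N g (a * t * b)
  iseqv :=
    { refl := fun _ _ _ _ => Iff.rfl
      symm := fun h a b g => (h a b g).symm
      trans := fun h h' a b g => (h a b g).trans (h' a b g) }
  mul' {w x y z} h h' a b g := by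
    have hwx := h a (y * b) g
    have hyz := h' (a * x) b g
    simp only [mul_assoc] at hwx hyz ⊢
    exact hwx.trans hyz

theorem cosetCon_le_syntacticCon [Finite S] (hN : N.Normal) : cosetCon he N ≤ syntacticCon N := by
  have not_inCoset {s : S} (hs : ∀ a ∈ JClass e, ¬ JLe a s) (a b : S) (g : MaxSubgroup he) :
      ¬ InCoset N g (a * s * b) := by
    rintro ⟨h, -, hh⟩
    exact hs _ h.elt_mem_jClass (hh ▸ (jLe_mul_right (a * s) b).trans (jLe_mul_left a s))
  refine Con.conGen_le.2 ?_
  rintro s t (⟨hs, ht⟩ | ⟨g, h, hgh, rfl, rfl⟩) a b m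
  · exact iff_of_false (not_inCoset hs a b m) (not_inCoset ht a b m)
  · have hhg : h⁻¹ * g ∈ N := by simpa only [mul_inv_rev, inv_inv] using N.inv_mem hgh
    exact ⟨.mul_elt_mul hN hgh, .mul_elt_mul hN hhg⟩

theorem inCoset_of_cosetCon [Finite S] (hN : N.Normal) {g : MaxSubgroup he} {s : S}
    (h : cosetCon he N g.elt s) : InCoset N g (e * s * e) := by
  refine (cosetCon_le_syntacticCon hN h e e g).1 ⟨g, ?_, ?_⟩
  · rw [inv_mul_cancel]
    exact N.one_mem
  · rw [g.idem_mul_elt, g.elt_mul_idem]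

namespace GMQuot

/-- The quotient map `S → GM_J(G/N)` as a homomorphism. -/
noncomputable def mkHom (he : IsIdempotentElem e) (N : Subgroup (MaxSubgroup he)) :
    S →ₙ* GMQuot he N where
  toFun := mk he N
  map_mul' _ _ := rfl

theorem mkHom_surjective (he : IsIdempotentElem e) (N : Subgroup (MaxSubgroup he)) :
    Function.Surjective (mkHom he N) :=
  Quotient.mk_surjective

instance [Finite S] : Finite (GMQuot he N) :=
  Finite.of_surjective _ (mkHom_surjective he N)

theorem closure_range_mk (he : IsIdempotentElem e) (N : Subgroup (MaxSubgroup he)) {X : Set S}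
    (hX : Subsemigroup.closure X = ⊤) :
    Subsemigroup.closure (Set.range fun x : X => mk he N x) = ⊤ := by
  have hrange : (Set.range fun x : X => mk he N x) = mkHom he N '' X :=
    (Set.image_eq_range _ _).symm
  rw [hrange, ← MulHom.map_mclosure, hX, ← MulHom.srange_eq_map,
    MulHom.srange_eq_top_iff_surjective]
  exact mkHom_surjective he N

theorem subsingleton_top (he : IsIdempotentElem e) : Subsingleton (GMQuot he ⊤) := by
  refine ⟨fun a b => ?_⟩
  obtain ⟨s, rfl⟩ := mkHom_surjective he ⊤ a
  obtain ⟨t, rfl⟩ := mkHom_surjective he ⊤ b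
  refine (Con.eq _).2 ?_
  rw [gmQuotCon, if_pos rfl]
  trivial

theorem mk_eq_mk_iff (hN : N ≠ ⊤) {s t : S} :
    mk he N s = mk he N t ↔
      gmCon (e : (cosetCon he N).Quotient) (s : (cosetCon he N).Quotient) t := by
  refine (Con.eq _).trans ?_
  rw [gmQuotCon, if_neg hN]
  exact Iff.rfl

theorem inCoset_of_mk_eq [Finite S] (hN : N.Normal) (htop : N ≠ ⊤) {s : S} {g : MaxSubgroup he}
    (h : mk he N g.elt = mk he N s) : InCoset N g (e * s * e) := by
  let π : S →ₙ* (cosetCon he N).Quotient := (cosetCon he N).mkMulHom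
  let p := MaxSubgroup.map π he g
  have heJ : π e ∈ JClass (π e) := (MaxSubgroup.map π he 1).elt_mem_jClass
  have hp : π e * π g.elt * π e = p.elt := by
    rw [← map_mul, ← map_mul, g.idem_mul_elt, g.elt_mul_idem, MaxSubgroup.elt_map]
  have heq := ((mk_eq_mk_iff htop).1 h _ heJ _ heJ).2 (hp ▸ p.elt_mem_jClass)
  have hcon : cosetCon he N g.elt (e * s * e) := (Con.eq _).1 (hp.symm.trans heq)
  simpa only [mul_assoc, he.eq, ← mul_assoc e e] using inCoset_of_cosetCon hN hcon

/-- The homomorphism from the maximal subgroup at `e` to the maximal subgroup of `GM_J(G/N)` at the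
image of `e`. -/
noncomputable def maxSubgroupHom (he : IsIdempotentElem e) (N : Subgroup (MaxSubgroup he)) :
    MaxSubgroup he →* MaxSubgroup (idem he N) :=
  MaxSubgroup.map (mkHom he N) he

instance : Subsingleton (MaxSubgroup (idem he ⊤)) :=
  have := subsingleton_top he
  MaxSubgroup.elt_injective.subsingleton

theorem ker_maxSubgroupHom [Finite S] (hN : N.Normal) : (maxSubgroupHom he N).ker = N := by
  obtain rfl | htop := eq_or_ne N ⊤
  · exact eq_top_iff.2 fun _ _ => Subsingleton.elim _ _
  ext g
  constructor
  · intro hg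
    obtain ⟨h, hh, hgh⟩ := inCoset_of_mk_eq hN htop (g := 1) (s := g.elt)
      (congrArg MaxSubgroup.elt (MonoidHom.mem_ker.1 hg)).symm
    rw [g.idem_mul_elt, g.elt_mul_idem] at hgh
    rwa [inv_one, one_mul, ← MaxSubgroup.elt_injective hgh] at hh
  · intro hg
    have hcon : (g.elt : (cosetCon he N).Quotient) = e :=
      (Con.eq _).2 (.of _ _ (.inr ⟨g, 1, N.mul_mem (N.inv_mem hg) N.one_mem, rfl, rfl⟩))
    exact MaxSubgroup.elt_injective ((mk_eq_mk_iff htop).2 <|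
      show gmCon _ (g.elt : (cosetCon he N).Quotient) (e : (cosetCon he N).Quotient) by
        rw [hcon]; exact Con.refl _ _)

theorem maxSubgroupHom_surjective [Finite S] (hN : N.Normal) :
    Function.Surjective (maxSubgroupHom he N) := by
  obtain rfl | htop := eq_or_ne N ⊤
  · exact fun p => ⟨1, Subsingleton.elim _ _⟩
  intro p
  obtain ⟨s, hs⟩ := mkHom_surjective he N p.elt
  obtain ⟨t, ht⟩ := mkHom_surjective he N p⁻¹.elt
  have hst : mk he N (s * e * t) = mk he N (1 : MaxSubgroup he).elt := by
    change mkHom he N (s * e * t) = _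
    rw [map_mul, map_mul, hs, ht]
    exact (congrArg (· * _) p.elt_mul_idem).trans p.elt_mul_elt_inv
  obtain ⟨g, -, hg⟩ := inCoset_of_mk_eq hN htop hst.symm
  have hesetg : e * s * e * (t * g⁻¹.elt) = e :=
    calc e * s * e * (t * g⁻¹.elt) = e * s * e * (t * (e * g⁻¹.elt)) := by rw [g⁻¹.idem_mul_elt]
      _ = e * (s * e * t) * e * g⁻¹.elt := by simp only [mul_assoc]
      _ = e := by rw [hg, g.elt_mul_elt_inv]
  obtain ⟨a, ha⟩ := MaxSubgroup.exists_elt_eq_of_mul_eq he (by rw [← mul_assoc, ← mul_assoc, he.eq])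
    (by rw [mul_assoc, he.eq]) hesetg
  refine ⟨a, MaxSubgroup.elt_injective ?_⟩
  change mkHom he N a.elt = p.elt
  rw [ha, map_mul, map_mul, hs]
  exact (congrArg (· * _) p.idem_mul_elt).trans p.elt_mul_idem

end GMQuot

end Quotients

/-! ## Pointlike subgroups -/

section Pointlike

variable {S T : Type u} [Semigroup S] [Semigroup T] {e : S} {he : IsIdempotentElem e} {k : ℕ}

theorem isGroupPointlike_singleton (k : ℕ) (g : MaxSubgroup he) : IsGroupPointlike k {g} := by
  intro U _ _ _ r
  obtain ⟨u, hu⟩ := r.total g.elt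
  refine ⟨u, ?_⟩
  rintro _ ⟨_, rfl, rfl⟩
  exact hu

theorem IsGroupPointlike.mono {Y Z : Set (MaxSubgroup he)} (hZ : IsGroupPointlike k Z)
    (hYZ : Y ⊆ Z) : IsGroupPointlike k Y := by
  intro U _ _ hU r
  obtain ⟨u, hu⟩ := hZ U hU r
  refine ⟨u, ?_⟩
  rintro _ ⟨g, hg, rfl⟩
  exact hu _ ⟨g, hYZ hg, rfl⟩

open Pointwise in
theorem IsGroupPointlike.mul {Y Z : Set (MaxSubgroup he)} (hY : IsGroupPointlike k Y)
    (hZ : IsGroupPointlike k Z) : IsGroupPointlike k (Y * Z) := by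
  intro U _ _ hU r
  obtain ⟨u, hu⟩ := hY U hU r
  obtain ⟨v, hv⟩ := hZ U hU r
  refine ⟨u * v, ?_⟩
  rintro _ ⟨_, ⟨y, hy, z, hz, rfl⟩, rfl⟩
  exact r.mul _ _ _ _ (hu _ ⟨y, hy, rfl⟩) (hv _ ⟨z, hz, rfl⟩)

theorem IsGroupPointlike.image {Z : Set (MaxSubgroup he)} (hZ : IsGroupPointlike k Z)
    (f : S →ₙ* T) : IsGroupPointlike k (MaxSubgroup.map f he '' Z) := by
  intro U _ _ hU r
  obtain ⟨u, hu⟩ := hZ U hU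
    { rel := fun s u => r.rel (f s) u
      total := fun s => r.total (f s)
      mul := fun _ _ _ _ h h' => by rw [map_mul]; exact r.mul _ _ _ _ h h' }
  refine ⟨u, ?_⟩
  rintro _ ⟨_, ⟨g, hg, rfl⟩, rfl⟩
  exact hu _ ⟨g, hg, rfl⟩

theorem IsGroupPointlike.preimage_maxSubgroupHom [Finite S] {N : Subgroup (MaxSubgroup he)}
    (hN : N.Normal) (hNk : IsGroupPointlike k (N : Set (MaxSubgroup he)))
    {Z : Set (MaxSubgroup (GMQuot.idem he N))} (hZ : IsGroupPointlike k Z) :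
    IsGroupPointlike k (GMQuot.maxSubgroupHom he N ⁻¹' Z) := by
  obtain rfl | htop := eq_or_ne N ⊤
  · exact hNk.mono (Set.subset_univ _)
  intro U _ _ hU r
  obtain ⟨u, hu⟩ := hZ U hU
    { rel := fun m u => ∃ s, GMQuot.mkHom he N s = m ∧ r.rel s u
      total := fun m => by
        obtain ⟨s, rfl⟩ := GMQuot.mkHom_surjective he N m
        obtain ⟨u, hu⟩ := r.total s
        exact ⟨u, s, rfl, hu⟩
      mul := by
        rintro _ u _ u' ⟨s, rfl, hs⟩ ⟨s', rfl, hs'⟩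
        exact ⟨s * s', map_mul _ _ _, r.mul _ _ _ _ hs hs'⟩ }
  obtain ⟨n, hn⟩ := hNk U hU r
  obtain ⟨v, hv⟩ := r.total e
  refine ⟨n * (v * u * v), ?_⟩
  rintro _ ⟨g, hg, rfl⟩
  obtain ⟨s, hs, hsu⟩ := hu _ ⟨_, hg, rfl⟩
  obtain ⟨h, hgh, hh⟩ := GMQuot.inCoset_of_mk_eq hN htop hs.symm
  have hghN : g * h⁻¹ ∈ N := by
    simpa only [mul_inv_rev, inv_inv] using N.inv_mem (hN.mem_comm hgh)
  rw [← inv_mul_cancel_right g h, MaxSubgroup.elt_mul, ← hh]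
  exact r.mul _ _ _ _ (hn _ ⟨_, hghN, rfl⟩) (r.mul _ _ _ _ (r.mul _ _ _ _ hv hsu) hv)

open Pointwise in
theorem exists_isGreatest_isGroupPointlike [Finite S] (he : IsIdempotentElem e) (k : ℕ) :
    ∃ Z, IsGreatest {Z : Set (MaxSubgroup he) | 1 ∈ Z ∧ IsGroupPointlike k Z} Z := by
  obtain ⟨Z, ⟨hZ1, hZ⟩, hmax⟩ := Set.Finite.exists_maximal
    (Set.toFinite {Z : Set (MaxSubgroup he) | 1 ∈ Z ∧ IsGroupPointlike k Z})
    ⟨{1}, rfl, isGroupPointlike_singleton k 1⟩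
  refine ⟨Z, ⟨hZ1, hZ⟩, fun Y ⟨hY1, hY⟩ => ?_⟩
  have hZY : Z * Y ⊆ Z :=
    hmax ⟨Set.mem_mul.2 ⟨1, hZ1, 1, hY1, mul_one 1⟩, hZ.mul hY⟩ (Set.subset_mul_left Z hY1)
  exact (Set.subset_mul_right Y hZ1).trans hZY

open Pointwise in
theorem exists_normal_isGreatest_isGroupPointlike [Finite S] (he : IsIdempotentElem e) (k : ℕ) :
    ∃ N : Subgroup (MaxSubgroup he), N.Normal ∧
      IsGreatest {Z : Set (MaxSubgroup he) | 1 ∈ Z ∧ IsGroupPointlike k Z} N := by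
  obtain ⟨Z, ⟨hZ1, hZ⟩, hmax⟩ := exists_isGreatest_isGroupPointlike he k
  have hZZ : Z * Z = Z :=
    (hmax ⟨Set.mem_mul.2 ⟨1, hZ1, 1, hZ1, mul_one 1⟩, hZ.mul hZ⟩).antisymm
      (Set.subset_mul_left Z hZ1)
  refine ⟨subgroupOfIdempotent Z ⟨1, hZ1⟩ hZZ, ⟨fun z hz g => ?_⟩, ⟨hZ1, hZ⟩, hmax⟩
  have hconj {x} (hx : x ∈ Z) : g * x * g⁻¹ ∈ {g} * Z * {g⁻¹} :=
    Set.mul_mem_mul (Set.mul_mem_mul rfl hx) rfl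
  refine hmax ⟨?_, ((isGroupPointlike_singleton k g).mul hZ).mul
    (isGroupPointlike_singleton k g⁻¹)⟩ (hconj hz)
  simpa only [mul_one, mul_inv_cancel] using hconj hZ1

theorem eq_bot_of_isGroupPointlike_gmQuot [Finite S] {N : Subgroup (MaxSubgroup he)}
    (hN : N.Normal)
    (hmax : IsGreatest {Z : Set (MaxSubgroup he) | 1 ∈ Z ∧ IsGroupPointlike k Z} N)
    {P : Subgroup (MaxSubgroup (GMQuot.idem he N))}
    (hP : IsGroupPointlike k (P : Set (MaxSubgroup (GMQuot.idem he N)))) : P = ⊥ := by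
  have hle : P.comap (GMQuot.maxSubgroupHom he N) ≤ N :=
    hmax.2 ⟨one_mem (P.comap _), hmax.1.2.preimage_maxSubgroupHom hN hP⟩
  rw [← Subgroup.map_comap_eq_self_of_surjective (GMQuot.maxSubgroupHom_surjective hN) P,
    Subgroup.map_eq_bot_iff, GMQuot.ker_maxSubgroupHom hN]
  exact hle

theorem le_of_mem_flowNormals [Finite S] {X : Set S} (hX : Subsemigroup.closure X = ⊤)
    {N : Subgroup (MaxSubgroup he)} (hN : N ∈ flowNormals he X k) {P : Subgroup (MaxSubgroup he)}
    (hP : IsGroupPointlike (k + 1) (P : Set (MaxSubgroup he))) : P ≤ N := by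
  obtain ⟨hN, hflow⟩ := hN
  have himage : (GMQuot.maxSubgroupHom he N '' P).Subsingleton :=
    hflow.subsingleton_of_isGroupPointlike (GMQuot.closure_range_mk he N hX) (hP.image _)
  rw [← GMQuot.ker_maxSubgroupHom hN]
  exact fun g hg => himage ⟨g, hg, rfl⟩ ⟨1, P.one_mem, map_one _⟩

end Pointlike

end KRComplexity

open KRComplexity in
theorem mainTheorem4_general {S : Type u} [Semigroup S] [Finite S] {X : Set S}
    (hX : Subsemigroup.closure X = ⊤) {e : S} (he : IsIdempotentElem e) (k : ℕ) :
    IsLeast (flowNormals he X k) (flowNormal he X (k + 1)) ∧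
      IsGreatest {P : Subgroup (MaxSubgroup he) | IsPointlike (k + 1) {s | ∃ g ∈ P, s = g.elt}}
        (flowNormal he X (k + 1)) := by
  obtain ⟨N, hN, hmax⟩ := exists_normal_isGreatest_isGroupPointlike he (k + 1)
  have hflow : N ∈ flowNormals he X k :=
    ⟨hN, admitsFlow_of_forall_isGroupPointlike _ fun _ => eq_bot_of_isGroupPointlike_gmQuot hN hmax⟩
  have hleast : IsLeast (flowNormals he X k) N :=
    ⟨hflow, fun _ hN' => le_of_mem_flowNormals hX hN' hmax.1.2⟩
  have heq : flowNormal he X (k + 1) = N := hleast.isGLB.sInf_eq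
  rw [heq]
  exact ⟨hleast, hmax.1.2, fun P hP => hmax.2 ⟨P.one_mem, hP⟩⟩

theorem mainTheorem4 {S : Type u} [SemigroupWithZero S] [Finite S] (J : Set S)
    (hS : KRComplexity.IsGM J) (X : Set S) (hX : Subsemigroup.closure X = ⊤)
    {e : S} (he : IsIdempotentElem e) (heJ : e ∈ J) (k : ℕ) (hk : 0 < k) :
    IsLeast (KRComplexity.flowNormals he X (k - 1)) (KRComplexity.flowNormal he X k) ∧
    IsGreatest
      {P : Subgroup (KRComplexity.MaxSubgroup he) |
        KRComplexity.IsPointlike k {s : S | ∃ g ∈ P, s = KRComplexity.MaxSubgroup.elt g}}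
      (KRComplexity.flowNormal he X k) := by
  obtain ⟨k, rfl⟩ := Nat.exists_eq_succ_of_ne_zero hk.ne'
  exact mainTheorem4_general hX he k
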